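/- **Setting.** Let $\mathcal G$ be a finite graph, $\mathcal Q$ a finite collection of connected subgraphs of $\mathcal G$, $d\ge 1$, $b\ge 0$ integers, $G>0$. For $\mathcal F\in\mathcal Q$ let $D(\mathcal F)=\max\{1,\operatorname{diam}\mathcal F\}$ (distances inside $\mathcal F$), $D_{\mathcal Q}=\max_{\mathcal F\in\mathcal Q}D(\mathcal F)$ (and $D_{\mathcal Q}=1$ if $\mathcal Q=\varnothing$), $k=\lfloor b/D_{\mathcal Q}\rfloor$, $\varepsilon=3\cdot 2^{-k/d}G$, $\nu=1/|\mathcal Q|$. Norms are Euclidean. In each round $t$ an adversary activates a node $I_t$, which plays $w_t\in\mathbb R^d$ and receives a subgradient $g_t$ at $w_t$ of a convex loss $\ell_t:\mathbb R^d\to\mathbb R$, with $\|g_t\|\le G$. The adversary may be adaptive. **Encoding.** $g_t$ is communicated as $k$ bits $\mathrm{enc}(g_t)\in\{0,1\}^k$ and decoded as $\hat g_t=\mathrm{dec}(\mathrm{enc}(g_t))$, where $(\mathrm{enc},\mathrm{dec})$ is fixed and satisfies $\|\mathrm{dec}(\mathrm{enc}(x))-x\|\le\varepsilon$ whenever $\|x\|\le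 G$. **Communication.** Each $\mathcal F\in\mathcal Q$ has its own copy of the algorithm, which only uses gradients produced at nodes of $\mathcal F$ and sent along edges of $\mathcal F$. At the end of round $t$ every node sends to its neighbours in $\mathcal F$ the gradient it has just produced, if any, and the gradients it received for the first time in round $t-1$, except those $\hat g_s$ with $t-s\ge D_{\mathcal Q}$, which are discarded. Let $S(t)$ be the set of indices of the gradients available to $I_t$ in this way when it plays in round $t$, and $\gamma_{\mathcal F}(t)=\{s<t: I_s\in\mathcal F\}\setminus S(t)$. **Algorithm on $\mathcal F$.** For $t$ with $I_t\in\mathcal F$ let $w_t^{\mathcal F}=v_tz_t$. Here $z_t$ is the AdaDelay-Dist prediction on the unit ball, i.e. the minimizer over $\|z\|\le1$ of $\langle\sum_{s\in S(t)}\hat g_s,z\rangle+\|z\|^2/(2\eta_t)$ with $$\eta_t=\Big(\sum_{s\in S(t)}\big(\|\hat g_s\|^2+2\|\hat g_s\|\sum_{i\in\gamma_{\mathcal F}(s)\cap S(t)}\|\hat g_i\|\big)+\big((2D(\mathcal F)+1)\,4G\big)^2\Big)^{-1/2},$$ and, with $\hat h_s=\langle z_s,\hat g_s\rangle$ and $\hat\zeta_t(s)=|\hat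 h_s+\varepsilon|\sum_{i\in\gamma_{\mathcal F}(s)\cap S(t)}|\hat h_i+\varepsilon|$, $$v_t=\mathbb E_{\eta\sim\rho}\Big[\nu\,\eta\,\exp\Big(-\sum_{s\in S(t)}\big(\eta(\hat h_s+\varepsilon)+\eta^2(\hat h_s+\varepsilon)^2+2\eta^2\hat\zeta_t(s)\big)\Big)\Big],$$ where $\rho$ has density proportional to $e^{-\eta^2}$ on $[0,a]$, $a=\big(20(4G+\varepsilon)(1+2D(\mathcal F))\big)^{-1}$. The learner plays $w_t=\sum_{\mathcal F\in\mathcal Q}w_t^{\mathcal F}\mathbf 1\{I_t\in\mathcal F\}$. **Theorem (Learning a $\mathcal Q$-partition, deterministic encoding).** There is an absolute constant $C>0$ such that, for all $\mathcal G,\mathcal Q,d,b,G$ as above: 1. an encoding $(\mathrm{enc},\mathrm{dec})$ as above exists; 2. in every round, the gradients that a node sends on behalf of all copies together take up at most $b$ bits ($k$ bits per distinct gradient); 3. for every such encoding, every horizon $T\ge0$ and all activations, losses and subgradients in the rounds $1,\dots,T$, the following holds simultaneously for all $\mathcal Q$-partitions $\{\mathcal F_1,\dots,\mathcal F_r\}$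 (vertex-disjoint elements of $\mathcal Q$ such that every activated node lies in one of them) and all $u_1,\dots,u_r\in\mathbb R^d$: $$\sum_{j=1}^r\mathcal R_{\mathcal F_j}(u_j)\le C\Big(1+\sum_{j=1}^r\|u_j\|\Big(\sqrt{(1+\Lambda(\mathcal F_j))\,L_j}+G\,D(\mathcal F_j)\,L_j+2^{-b/(dD_{\mathcal Q})}\,T_jG\Big)\Big),$$ where $L_j=\ln\big(1+|\mathcal Q|D(\mathcal F_j)\|u_j\|T_jG\big)$, $T_j=|\{t\le T:I_t\in\mathcal F_j\}|$, $\mathcal R_{\mathcal F_j}(u_j)=\sum_{t\le T:\,I_t\in\mathcal F_j}(\ell_t(w_t)-\ell_t(u_j))$ and $\Lambda(\mathcal F_j)=\sum_{t\le T:\,I_t\in\mathcal F_j}\big(\|g_t\|^2+2\|g_t\|\sum_{i\in\gamma_{\mathcal F_j}(t)}\|g_i\|\big)$. -/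

import Mathlib

/-!
Distributed online convex optimization on a graph with delayed and compressed gradients.
Rounds are numbered `0, 1, …, T - 1`; `I t` is the node that is active in round `t`.
-/

namespace DOCO

noncomputable section

open scoped Classical

/-- Points of `ℝ^d` with the Euclidean norm. -/
abbrev Vec (d : ℕ) := EuclideanSpace ℝ (Fin d)

/-! ### Subgraphs, delays and the bit budget -/

/-- `D(F) = max {1, diam F}`; the diameter is taken with respect to distances inside `F`. -/
def delay {V : Type*} {𝒢 : SimpleGraph V} (F : 𝒢.Subgraph) : ℕ :=
  max 1 F.coe.diam

/-- `D_Q`, the maximum of `D(F)` over `F ∈ Q` (equal to `1` if `Q` is empty). -/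
def maxDelay {V : Type*} {𝒢 : SimpleGraph V} (Q : Finset 𝒢.Subgraph) : ℕ :=
  max 1 (Q.sup delay)

/-- The number `k = ⌊b / D_Q⌋` of bits per gradient. -/
def bitsPerGradient {V : Type*} {𝒢 : SimpleGraph V} (Q : Finset 𝒢.Subgraph) (b : ℕ) : ℕ :=
  b / maxDelay Q

/-- A `Q`-partition for the first `T` rounds: a vertex-disjoint subcollection of `Q` such that
every node that is ever activated lies in one of its members. -/
structure IsQPartition {V : Type*} {𝒢 : SimpleGraph V} (Q : Finset 𝒢.Subgraph)
    (I : ℕ → V) (T : ℕ) (P : Finset 𝒢.Subgraph) : Prop where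
  subset : P ⊆ Q
  disjoint : ∀ F ∈ P, ∀ F' ∈ P, F ≠ F' → Disjoint F.verts F'.verts
  covers : ∀ t < T, ∃ F ∈ P, I t ∈ F.verts

/-! ### Deterministic encodings -/

/-- The guaranteed resolution `ε = 3 · 2^{-k/d} G` of a `k`-bit encoding of the ball of
radius `G` in `ℝ^d`. -/
def resolution (d k : ℕ) (G : ℝ) : ℝ :=
  3 * (2 : ℝ) ^ (-((k : ℝ) / (d : ℝ))) * G

/-- A deterministic `k`-bit encoding, with encoder `enc` and decoder `dec`, that represents every
gradient of norm at most `G` up to the error `ε = 3 · 2^{-k/d} G`. -/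
def IsCoverEncoding {d : ℕ} (k : ℕ) (G : ℝ) (enc : Vec d → (Fin k → Bool))
    (dec : (Fin k → Bool) → Vec d) : Prop :=
  ∀ x : Vec d, ‖x‖ ≤ G → ‖dec (enc x) - x‖ ≤ resolution d k G

/-! ### Communication: the standard forwarding strategy inside a subgraph

Gradients are identified by the round in which they were produced. -/

/-- The gradient produced by node `n` itself in round `t`, seen inside `F`. -/
def ownGradient {V : Type*} {𝒢 : SimpleGraph V} (F : 𝒢.Subgraph) (I : ℕ → V) (t : ℕ) (n : V) :
    Finset ℕ :=
  if I t = n ∧ n ∈ F.verts then {t} else ∅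

/-- What a node sends to all its neighbours at the end of round `t`: the gradient that it has just
produced and the gradients `pending` that it received for the first time in the previous round;
a gradient is no longer sent once `Dmax` rounds have passed since it was produced. -/
def outgoing (Dmax t : ℕ) (own pending : Finset ℕ) : Finset ℕ :=
  (own ∪ pending).filter fun s => t - s < Dmax

/-- The state of node `n` at the start of round `t`, for communication along edges of `F` only.
First component: all gradients available at `n`.  Second component: the gradients that `n` received
for the first time in the previous round, to be forwarded in round `t`. -/
def nodeState {V : Type*} [Fintype V] {𝒢 : SimpleGraph V} (F : 𝒢.Subgraph) (Dmax : ℕ)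
    (I : ℕ → V) : ℕ → V → Finset ℕ × Finset ℕ
  | 0, _ => (∅, ∅)
  | t + 1, n =>
    let old := (nodeState F Dmax I t n).1 ∪ ownGradient F I t n
    let received := (Finset.univ.filter fun m => F.Adj m n).biUnion fun m =>
      outgoing Dmax t (ownGradient F I t m) (nodeState F Dmax I t m).2
    (old ∪ received, received \ old)

/-- The gradients whose compressed versions node `n` puts in its message of round `t`,
on behalf of the copy of the algorithm that runs on `F`. -/
def message {V : Type*} [Fintype V] {𝒢 : SimpleGraph V} (F : 𝒢.Subgraph) (Dmax : ℕ)
    (I : ℕ → V) (t : ℕ) (n : V) : Finset ℕ :=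
  outgoing Dmax t (ownGradient F I t n) (nodeState F Dmax I t n).2

/-- `S(t, F)`: the gradients available inside `F` to the active node `I t` when it predicts. -/
def available {V : Type*} [Fintype V] {𝒢 : SimpleGraph V} (F : 𝒢.Subgraph) (Dmax : ℕ)
    (I : ℕ → V) (t : ℕ) : Finset ℕ :=
  (nodeState F Dmax I t (I t)).1

/-- `γ_F(t)`: the earlier gradients of `F` that are missing at the active node in round `t`. -/
def missing {V : Type*} [Fintype V] {𝒢 : SimpleGraph V} (F : 𝒢.Subgraph) (Dmax : ℕ)
    (I : ℕ → V) (t : ℕ) : Finset ℕ :=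
  ((Finset.range t).filter fun s => I s ∈ F.verts) \ available F Dmax I t

/-! ### The algorithm for one subgraph

In this part `S t` and `γ t` are the sets of available and of missing gradients in round `t`, and
`D` is a bound on the delay.  The set `γ s ∩ S t` consists of the gradients that were missing in
round `s` and are available in round `t`. -/

/-- The lag of the gradients `g` that are available in round `t`, as far as it is known then. -/
def observedLag {d : ℕ} (S γ : ℕ → Finset ℕ) (g : ℕ → Vec d) (t : ℕ) : ℝ :=
  ∑ s ∈ S t, (‖g s‖ ^ 2 + 2 * ‖g s‖ * ∑ i ∈ γ s ∩ S t, ‖g i‖)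

/-- The Euclidean projection onto the closed unit ball. -/
def projUnitBall {d : ℕ} (x : Vec d) : Vec d :=
  (max 1 ‖x‖)⁻¹ • x

/-- AdaDelay-Dist on the unit ball for gradients of norm at most `B`: delayed dual averaging, i.e.
the minimizer over the unit ball of `⟨∑ s ∈ S t, g s, z⟩ + ‖z‖² / (2 η_t)`, with the learning rate
`η_t = 1 / √(observed lag + (2 D + 1)² B²)`. -/
def adaDelayDist {d : ℕ} (D : ℕ) (B : ℝ) (S γ : ℕ → Finset ℕ) (g : ℕ → Vec d) (t : ℕ) : Vec d :=
  projUnitBall (-((√(observedLag S γ g t + ((2 * (D : ℝ) + 1) * B) ^ 2))⁻¹ • ∑ s ∈ S t, g s))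

/-- The correction `|h s + ε| ∑ |h i + ε|` for missing gradients, over those `i` that were missing
in round `s` and are available in round `t`. -/
def lagCorrection (ε : ℝ) (S γ : ℕ → Finset ℕ) (h : ℕ → ℝ) (t s : ℕ) : ℝ :=
  |h s + ε| * ∑ i ∈ γ s ∩ S t, |h i + ε|

/-- The one-dimensional comparator-adaptive algorithm, with parameters `ν`, `B`, `ε`, on a graph
with delay `D`: the expectation of
`ν exp(-∑ s ∈ S t, (η (h s + ε) + η² (h s + ε)² + 2 η² lagCorrection)) η`
under the law of `η` on `[0, a]` with density `exp (-η²) / Z`, where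
`a = 1 / (20 (B + ε) (1 + 2 D))` and `Z` is the normalizing constant. -/
def scalePrediction (ν : ℝ) (D : ℕ) (B ε : ℝ) (S γ : ℕ → Finset ℕ) (h : ℕ → ℝ) (t : ℕ) : ℝ :=
  let a : ℝ := ((B + ε) * 20 * (1 + 2 * (D : ℝ)))⁻¹
  let Z : ℝ := ∫ η in (0 : ℝ)..a, Real.exp (-η ^ 2)
  (∫ η in (0 : ℝ)..a,
    ν * Real.exp (-∑ s ∈ S t, (η * (h s + ε) + η ^ 2 * (h s + ε) ^ 2
      + 2 * η ^ 2 * lagCorrection ε S γ h t s)) * η * Real.exp (-η ^ 2)) / Z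

/-- The black-box combination `v_t z_t` of the two: `z` is produced by AdaDelay-Dist from the
approximate gradients `ghat`, and `v` by the one-dimensional algorithm from `⟨z_s, ghat_s⟩`. -/
def combinedPrediction {d : ℕ} (ν : ℝ) (D : ℕ) (B ε : ℝ) (S γ : ℕ → Finset ℕ)
    (ghat : ℕ → Vec d) (t : ℕ) : Vec d :=
  let z := adaDelayDist D B S γ ghat
  scalePrediction ν D B ε S γ (fun s => inner ℝ (z s) (ghat s)) t • z t

/-! ### The learner -/

/-- The iterate `w_t^F` of the copy that runs on `F ∈ Q`: it only uses gradients produced and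
communicated inside `F`, and is tuned with `ν = 1 / |Q|`, the upper bound `4 G` on the norms of the
approximate gradients `ghat`, and the error parameter `ε = 3 · 2^{-k/d} G`. -/
def subgraphIterate {V : Type*} [Fintype V] {𝒢 : SimpleGraph V} {d : ℕ} (Q : Finset 𝒢.Subgraph)
    (b : ℕ) (G : ℝ) (I : ℕ → V) (ghat : ℕ → Vec d) (F : 𝒢.Subgraph) (t : ℕ) : Vec d :=
  combinedPrediction (1 / (Q.card : ℝ)) (delay F) (4 * G)
    (resolution d (bitsPerGradient Q b) G)
    (available F (maxDelay Q) I) (missing F (maxDelay Q) I) ghat t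

/-- The prediction `w_t`: the sum of the iterates of those `F ∈ Q` that contain the active node,
when the true gradients are `g`. -/
def prediction {V : Type*} [Fintype V] {𝒢 : SimpleGraph V} {d : ℕ} (Q : Finset 𝒢.Subgraph)
    (b : ℕ) (G : ℝ) (enc : Vec d → (Fin (bitsPerGradient Q b) → Bool))
    (dec : (Fin (bitsPerGradient Q b) → Bool) → Vec d)
    (I : ℕ → V) (g : ℕ → Vec d) (t : ℕ) : Vec d :=
  ∑ F ∈ Q.filter (fun F => I t ∈ F.verts),
    subgraphIterate Q b G I (fun s => dec (enc (g s))) F t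

/-- `g` is a subgradient of `f` at `x`. -/
def IsSubgradientAt {d : ℕ} (f : Vec d → ℝ) (g x : Vec d) : Prop :=
  ∀ y : Vec d, f x + inner ℝ g (y - x) ≤ f y

/-! ### Regret and the quantities in the bound -/

/-- The rounds before `T` in which the active node belongs to `F`. -/
def activeRounds {V : Type*} {𝒢 : SimpleGraph V} (F : 𝒢.Subgraph) (I : ℕ → V) (T : ℕ) :
    Finset ℕ :=
  (Finset.range T).filter fun t => I t ∈ F.verts

/-- The joint regret `R_F(u)` of the predictions `w` over the rounds that are active in `F`. -/
def regret {V : Type*} {𝒢 : SimpleGraph V} {d : ℕ} (F : 𝒢.Subgraph) (I : ℕ → V) (T : ℕ)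
    (loss : ℕ → Vec d → ℝ) (w : ℕ → Vec d) (u : Vec d) : ℝ :=
  ∑ t ∈ activeRounds F I T, (loss t (w t) - loss t u)

/-- The lag `Λ(F)` of the true gradients in `F`. -/
def lag {V : Type*} [Fintype V] {𝒢 : SimpleGraph V} {d : ℕ} (F : 𝒢.Subgraph) (Dmax : ℕ)
    (I : ℕ → V) (T : ℕ) (g : ℕ → Vec d) : ℝ :=
  ∑ t ∈ activeRounds F I T, (‖g t‖ ^ 2 + 2 * ‖g t‖ * ∑ i ∈ missing F Dmax I t, ‖g i‖)

/-- The logarithm `ln (1 + |Q| D(F) ‖u‖ T_F G)`. -/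
def logFactor {V : Type*} {𝒢 : SimpleGraph V} {d : ℕ} (Q : Finset 𝒢.Subgraph) (F : 𝒢.Subgraph)
    (I : ℕ → V) (T : ℕ) (G : ℝ) (u : Vec d) : ℝ :=
  Real.log (1 + (Q.card : ℝ) * (delay F : ℝ) * ‖u‖ * ((activeRounds F I T).card : ℝ) * G)

end

end DOCO

/-!
The joint regret over a partition `P ⊆ Q` is at most the sum over all `F ∈ Q` of the linearized
regret of the copy that runs on `F`, against `u F` for `F ∈ P` and against `0` otherwise
(`sum_regret_le`), because the learner plays the sum of the copies and the active node lies in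
exactly one member of `P`. So it suffices that each copy has regret at most `2 / |Q|` plus a term
proportional to the norm of the comparator (`combinedPrediction_regret`).

For one copy, the graph enters only through the fact that a gradient produced in `F` reaches every
node of `F` within `D(F)` rounds (`lt_add_delay_of_mem_missing`). This leaves a delayed online
learning problem, described by `IsDelayed`, in which the available sets need not be nested. Its
engine is `totalLag_sub_knownLag_le`: the part of the lag that the active node cannot see is at most
`(1 + 4 D) B` times the sum of the missing gradient norms. Write `h t = ⟪z t, ghat t⟫` and
`x t = h t + ε`, where `z t` is the direction. The regret against `u` splits into three parts.

* The direction `z t` against `u / ‖u‖` (`adaDelayDist_regret`). Dual averaging with all past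
  gradients and the full lag is an instance of follow-the-regularized-leader with nondecreasing
  regularization, hence has the usual regret bound. The delayed prediction differs from it by at
  most three times the missing gradient mass times the learning rate: the missing gradients shift
  the dual average, and an error in the learning rate matters only through its relative size, since
  long multiples of one vector have the same projection onto the ball. These differences add up to
  a multiple of the square root of the lag.
* The scale `v t` against `‖u‖` (`scalePrediction_regret`). For each fixed learning rate `η` in the
  allowed range, `η * x t` times the known exponential is at most the decrease of the potential
  `exp (-η ∑ x - η² lag)` (`mul_knownPotential_le`). Integration over `η` bounds the cumulative loss
  by `ν (1 - E)`, with `E` the expected final potential. If the gain of the comparator exceeds the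
  claimed bound, then `E` is so large around a good `η` that it pays for the comparator
  (`mul_le_integral_div`).
* The compression error, at most `2 ε ‖u‖` per round.

If the argument of the logarithm is at most `2`, all that `u` can gain is at most `ν`, and the bound
on the cumulative loss alone suffices.

The encoding exists because an `ε`-separated set in the ball of radius `G ≥ ε` has at most
`(3 G / ε) ^ d = 2 ^ k` elements, by comparing volumes. The bit budget is kept since a message
contains only gradients from the last `D_Q` rounds.
-/

namespace DOCO

open scoped Classical

/-! ### Forwarding of gradients inside a subgraph -/

section Communication

variable {V : Type*} {𝒢 : SimpleGraph V} {F : 𝒢.Subgraph} {Dmax : ℕ} {I : ℕ → V}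

theorem mem_ownGradient {t s : ℕ} {n : V} :
    s ∈ ownGradient F I t n ↔ s = t ∧ I t = n ∧ n ∈ F.verts := by
  unfold ownGradient
  split_ifs with h <;> simp [h]

theorem delay_le_maxDelay {Q : Finset 𝒢.Subgraph} (hF : F ∈ Q) : delay F ≤ maxDelay Q :=
  (Finset.le_sup hF).trans (le_max_right _ _)

variable [Fintype V]

theorem nodeState_succ_fst (t : ℕ) (n : V) :
    (nodeState F Dmax I (t + 1) n).1 =
      ((nodeState F Dmax I t n).1 ∪ ownGradient F I t n) ∪
        (Finset.univ.filter fun m => F.Adj m n).biUnion fun m => message F Dmax I t m := rfl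

theorem nodeState_succ_snd (t : ℕ) (n : V) :
    (nodeState F Dmax I (t + 1) n).2 =
      ((Finset.univ.filter fun m => F.Adj m n).biUnion fun m => message F Dmax I t m) \
        ((nodeState F Dmax I t n).1 ∪ ownGradient F I t n) := rfl

theorem mem_message {t s : ℕ} {n : V} :
    s ∈ message F Dmax I t n ↔
      (s ∈ ownGradient F I t n ∨ s ∈ (nodeState F Dmax I t n).2) ∧ t - s < Dmax := by
  simp [message, outgoing]

theorem nodeState_lt (t : ℕ) (n : V) (s : ℕ)
    (h : s ∈ (nodeState F Dmax I t n).1 ∨ s ∈ (nodeState F Dmax I t n).2) :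
    s < t ∧ I s ∈ F.verts := by
  induction t generalizing n with
  | zero => simp [nodeState] at h
  | succ t ih =>
    have own : ∀ m, s ∈ ownGradient F I t m → s < t + 1 ∧ I s ∈ F.verts := by
      intro m hm
      obtain ⟨rfl, h2, h3⟩ := mem_ownGradient.1 hm
      exact ⟨by omega, h2 ▸ h3⟩
    have msg : ∀ m, s ∈ message F Dmax I t m → s < t + 1 ∧ I s ∈ F.verts := by
      intro m hm
      rcases (mem_message.1 hm).1 with h | h
      · exact own m h
      · obtain ⟨h1, h2⟩ := ih m (Or.inr h)
        exact ⟨by omega, h2⟩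
    rw [nodeState_succ_fst, nodeState_succ_snd] at h
    simp only [Finset.mem_union, Finset.mem_biUnion, Finset.mem_sdiff] at h
    rcases h with ((h | h) | ⟨m, _, h⟩) | ⟨⟨m, _, h⟩, _⟩
    · obtain ⟨h1, h2⟩ := ih n (Or.inl h)
      exact ⟨by omega, h2⟩
    · exact own n h
    · exact msg m h
    · exact msg m h

theorem message_le {t s : ℕ} {n : V} (h : s ∈ message F Dmax I t n) :
    s ≤ t ∧ t < s + Dmax := by
  obtain ⟨h1, h2⟩ := mem_message.1 h
  have hs : s ≤ t := by
    rcases h1 with h1 | h1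
    · exact (mem_ownGradient.1 h1).1.le
    · exact (nodeState_lt t n s (Or.inr h1)).1.le
  omega

/-- Only gradients of the last `maxDelay Q` rounds are ever forwarded, so the messages sent on
behalf of all copies fit into the budget of `b` bits. -/
theorem card_mul_bitsPerGradient_le (Q : Finset 𝒢.Subgraph) (b : ℕ) (I : ℕ → V) (t : ℕ) (n : V)
    (s : Finset ℕ) (hs : ∀ i ∈ s, ∃ F ∈ Q, i ∈ message F (maxDelay Q) I t n) :
    s.card * bitsPerGradient Q b ≤ b := by
  have hsub : s ⊆ Finset.Ioc (t - maxDelay Q) t ∪ (if t < maxDelay Q then {0} else ∅) := by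
    intro i hi
    obtain ⟨F, _, h⟩ := hs i hi
    have := message_le h
    split_ifs with h0 <;> simp <;> omega
  have hcard : s.card ≤ maxDelay Q := by
    refine (Finset.card_le_card hsub).trans ((Finset.card_union_le _ _).trans ?_)
    split_ifs with h0 <;> simp <;> omega
  calc s.card * bitsPerGradient Q b ≤ maxDelay Q * (b / maxDelay Q) :=
        Nat.mul_le_mul_right _ hcard
    _ ≤ b := Nat.mul_div_le _ _

theorem nodeState_mono {s t t' : ℕ} {n : V} (h : s ∈ (nodeState F Dmax I t n).1) (htt : t ≤ t') :
    s ∈ (nodeState F Dmax I t' n).1 := by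
  induction htt with
  | refl => exact h
  | step _ ih =>
    rw [nodeState_succ_fst]
    simp [ih]

/-- A node that holds a gradient which is not yet discarded has already sent it, or sends it
now. -/
theorem exists_message_of_mem_nodeState {s t : ℕ} {n : V} (hts : t - s < Dmax)
    (h : s ∈ (nodeState F Dmax I t n).1) : ∃ τ ≤ t, s ∈ message F Dmax I τ n := by
  induction t with
  | zero => simp [nodeState] at h
  | succ t ih =>
    by_cases hold : s ∈ (nodeState F Dmax I t n).1
    · obtain ⟨τ, hτ, h'⟩ := ih (by omega) hold
      exact ⟨τ, by omega, h'⟩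
    by_cases hown : s ∈ ownGradient F I t n
    · exact ⟨t, by omega, mem_message.2 ⟨Or.inl hown, by omega⟩⟩
    · refine ⟨t + 1, le_rfl, mem_message.2 ⟨Or.inr ?_, hts⟩⟩
      rw [nodeState_succ_fst] at h
      rw [nodeState_succ_snd]
      simp only [Finset.mem_union, Finset.mem_sdiff, hold, hown, false_or] at h ⊢
      exact ⟨h, by simp⟩

theorem mem_nodeState_of_message {s τ : ℕ} {m n : V} (hadj : F.Adj m n)
    (h : s ∈ message F Dmax I τ m) : s ∈ (nodeState F Dmax I (τ + 1) n).1 := by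
  rw [nodeState_succ_fst]
  simp only [Finset.mem_union, Finset.mem_biUnion, Finset.mem_filter, Finset.mem_univ, true_and]
  exact Or.inr ⟨m, hadj, h⟩

/-- Forwarding along a walk: a node joined to the source of a gradient by a walk of length
`m < Dmax` sends it within `m` rounds. -/
theorem exists_message_of_walk {s : ℕ} {x y : F.verts} (p : F.coe.Walk x y) (hy : I s = y)
    (hp : p.length < Dmax) : ∃ τ ≤ s + p.length, s ∈ message F Dmax I τ x := by
  induction p with
  | nil => exact ⟨s, by simp, mem_message.2 ⟨Or.inl (mem_ownGradient.2 ⟨rfl, hy, by simp⟩),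
      by simp at hp; omega⟩⟩
  | cons hadj p ih =>
    simp only [SimpleGraph.Walk.length_cons] at hp ⊢
    obtain ⟨τ, hτ, hm⟩ := ih hy (by omega)
    obtain ⟨τ', hτ', hm'⟩ := exists_message_of_mem_nodeState (by omega)
      (mem_nodeState_of_message (SimpleGraph.Subgraph.Adj.symm hadj) hm)
    exact ⟨τ', by omega, hm'⟩

theorem mem_nodeState_of_walk {s t : ℕ} {x y : F.verts} (p : F.coe.Walk x y) (hy : I s = y)
    (hp : p.length ≤ Dmax) (ht : s + p.length ≤ t) (hst : s < t) :
    s ∈ (nodeState F Dmax I t x).1 := by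
  cases p with
  | nil =>
    refine nodeState_mono (t := s + 1) ?_ hst
    rw [nodeState_succ_fst]
    have : s ∈ ownGradient F I s x := mem_ownGradient.2 ⟨rfl, hy, by simp⟩
    simp [this]
  | cons hadj p =>
    simp only [SimpleGraph.Walk.length_cons] at hp ht
    obtain ⟨τ, hτ, hm⟩ := exists_message_of_walk (Dmax := Dmax) p hy (by omega)
    exact nodeState_mono (mem_nodeState_of_message (SimpleGraph.Subgraph.Adj.symm hadj) hm)
      (by omega)

theorem available_subset (F : 𝒢.Subgraph) (Dmax : ℕ) (I : ℕ → V) (t : ℕ) :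
    available F Dmax I t ⊆ (Finset.range t).filter fun s => I s ∈ F.verts := by
  intro s hs
  simpa using nodeState_lt t (I t) s (Or.inl hs)

/-- A gradient that is missing in round `t` was produced fewer than `D(F)` rounds before `t`. -/
theorem lt_add_delay_of_mem_missing {t i : ℕ} (hF : F.Connected)
    (hD : delay F ≤ Dmax) (ht : I t ∈ F.verts) (hi : i ∈ missing F Dmax I t) :
    t < i + delay F := by
  simp only [missing, Finset.mem_sdiff, Finset.mem_filter, Finset.mem_range] at hi
  obtain ⟨⟨hit, hiF⟩, hnot⟩ := hi
  by_contra hlt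
  have hc : F.coe.Connected := hF
  have : Nonempty F.verts := ⟨⟨_, ht⟩⟩
  obtain ⟨p, hp⟩ := (hc.preconnected ⟨I t, ht⟩ ⟨I i, hiF⟩).exists_walk_length_eq_dist
  have hdist : p.length ≤ delay F := by
    rw [hp]
    exact (SimpleGraph.dist_le_diam (SimpleGraph.connected_iff_ediam_ne_top.1 hc)).trans
      (le_max_right _ _)
  exact hnot (mem_nodeState_of_walk p rfl (hdist.trans hD) (by omega) hit)

end Communication

/-! ### Existence of the encoding -/

section Encoding

open Metric MeasureTheory Module Set
open scoped ENNReal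

/-- Volume comparison: `ε/2`-balls around the points of an `ε`-separated subset of the ball of
radius `G` are disjoint and lie in the ball of radius `G + ε/2`. -/
theorem card_mul_pow_le_of_separated {E : Type*} [NormedAddCommGroup E] [NormedSpace ℝ E]
    [FiniteDimensional ℝ E] {G ε : ℝ} (hG : 0 < G) (hε : 0 < ε) (s : Finset E)
    (hs : ∀ c ∈ s, ‖c‖ ≤ G) (h : ∀ c ∈ s, ∀ c' ∈ s, c ≠ c' → ε ≤ ‖c - c'‖) :
    (s.card : ℝ) * (ε / 2) ^ finrank ℝ E ≤ (G + ε / 2) ^ finrank ℝ E := by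
  borelize E
  let μ : Measure E := Measure.addHaar
  have hδ : 0 < ε / 2 := by positivity
  have hρ : 0 < G + ε / 2 := by positivity
  have hdisj : Set.Pairwise (s : Set E)
      (Function.onFun Disjoint fun c => ball (c : E) (ε / 2)) := by
    rintro c hc c' hc' hcc
    apply ball_disjoint_ball
    rw [dist_eq_norm, add_halves]
    exact h c hc c' hc' hcc
  have hsub : (⋃ c ∈ s, ball (c : E) (ε / 2)) ⊆ ball (0 : E) (G + ε / 2) := by
    refine iUnion₂_subset fun x hx => ball_subset_ball' ?_
    rw [dist_zero_right, add_comm]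
    exact add_le_add_left (hs x hx) _
  have hvol : (s.card : ℝ≥0∞) * ENNReal.ofReal ((ε / 2) ^ finrank ℝ E) * μ (ball 0 1) ≤
      ENNReal.ofReal ((G + ε / 2) ^ finrank ℝ E) * μ (ball 0 1) :=
    calc
      (s.card : ℝ≥0∞) * ENNReal.ofReal ((ε / 2) ^ finrank ℝ E) * μ (ball 0 1)
          = μ (⋃ c ∈ s, ball (c : E) (ε / 2)) := by
        rw [measure_biUnion_finset hdisj fun c _ => measurableSet_ball]
        simp only [μ.addHaar_ball_of_pos _ hδ]
        simp only [Finset.sum_const, nsmul_eq_mul, mul_assoc]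
      _ ≤ μ (ball (0 : E) (G + ε / 2)) := measure_mono hsub
      _ = ENNReal.ofReal ((G + ε / 2) ^ finrank ℝ E) * μ (ball 0 1) := by
        simp only [μ.addHaar_ball_of_pos _ hρ]
  have hcancel : (s.card : ℝ≥0∞) * ENNReal.ofReal ((ε / 2) ^ finrank ℝ E) ≤
      ENNReal.ofReal ((G + ε / 2) ^ finrank ℝ E) :=
    (ENNReal.mul_le_mul_iff_left (measure_ball_pos _ _ zero_lt_one).ne' measure_ball_lt_top.ne).1
      hvol
  have := ENNReal.toReal_le_of_le_ofReal (pow_nonneg hρ.le _) hcancel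
  simpa [ENNReal.toReal_ofReal (pow_nonneg hδ.le _)] using this

theorem resolution_pos {d k : ℕ} {G : ℝ} (hG : 0 < G) : 0 < resolution d k G := by
  unfold resolution; positivity

theorem resolution_le {d k : ℕ} {G : ℝ} (hG : 0 < G) : resolution d k G ≤ 3 * G := by
  have : (2 : ℝ) ^ (-((k : ℝ) / (d : ℝ))) ≤ 1 :=
    Real.rpow_le_one_of_one_le_of_nonpos one_le_two (neg_nonpos.2 (by positivity))
  unfold resolution
  nlinarith

theorem two_pow_mul_resolution_pow {d k : ℕ} {G : ℝ} (hd : 0 < d) :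
    (2 : ℝ) ^ k * (resolution d k G) ^ d = (3 * G) ^ d := by
  have : ((2 : ℝ) ^ (-((k : ℝ) / (d : ℝ)))) ^ d = ((2 : ℝ) ^ k)⁻¹ := by
    rw [← Real.rpow_natCast, ← Real.rpow_mul zero_le_two]
    have : -((k : ℝ) / d) * d = -(k : ℝ) := by field_simp
    rw [this, Real.rpow_neg zero_le_two, Real.rpow_natCast]
  unfold resolution
  rw [mul_pow, mul_pow, mul_pow, this]
  field_simp

/-- When `ε ≤ G`, an `ε`-separated set in the ball of radius `G` has at most
`(1 + 2 G / ε) ^ d ≤ (3 G / ε) ^ d = 2 ^ k` points. -/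
theorem card_le_two_pow_of_separated {d k : ℕ} {G : ℝ} (hd : 0 < d) (hG : 0 < G)
    (hle : resolution d k G ≤ G) (s : Finset (Vec d)) (hs : ∀ c ∈ s, ‖c‖ ≤ G)
    (h : ∀ c ∈ s, ∀ c' ∈ s, c ≠ c' → resolution d k G ≤ ‖c - c'‖) : s.card ≤ 2 ^ k := by
  set ε := resolution d k G
  have hε : 0 < ε := resolution_pos hG
  have hcard := card_mul_pow_le_of_separated hG hε s hs h
  rw [finrank_euclideanSpace_fin] at hcard
  have h2 : (G + ε / 2) ^ d ≤ (3 * G / 2) ^ d :=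
    pow_le_pow_left₀ (by positivity) (by linarith) d
  have h3 : (3 * G / 2) ^ d = 2 ^ k * (ε / 2) ^ d := by
    rw [div_pow, div_pow, ← two_pow_mul_resolution_pow (k := k) hd, mul_div_assoc]
  have h4 : (s.card : ℝ) ≤ 2 ^ k :=
    le_of_mul_le_mul_right (hcard.trans (h2.trans h3.le)) (by positivity)
  exact_mod_cast h4

theorem exists_isCoverEncoding {d k : ℕ} {G : ℝ} (hd : 0 < d) (hG : 0 < G) :
    ∃ (enc : Vec d → (Fin k → Bool)) (dec : (Fin k → Bool) → Vec d),
      IsCoverEncoding k G enc dec := by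
  rcases le_total G (resolution d k G) with hle | hle
  · exact ⟨fun _ _ => true, fun _ => 0, fun x hx => by simpa using hx.trans hle⟩
  set ε := resolution d k G with hεdef
  let p : ℕ → Prop := fun n => ∃ s : Finset (Vec d), s.card = n ∧ (∀ c ∈ s, ‖c‖ ≤ G) ∧
    ∀ c ∈ s, ∀ c' ∈ s, c ≠ c' → ε ≤ ‖c - c'‖
  have hp0 : p 0 := ⟨∅, by simp⟩
  obtain ⟨s, hcard, hsG, hsep⟩ := Nat.findGreatest_spec (P := p) (Nat.zero_le (2 ^ k)) hp0
  have hs2 : s.card ≤ 2 ^ k := card_le_two_pow_of_separated hd hG hle s hsG hsep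
  have hcover : ∀ x : Vec d, ‖x‖ ≤ G → ∃ c ∈ s, ‖c - x‖ ≤ ε := by
    intro x hx
    by_contra! hfar
    have hxs : x ∉ s := fun hxs => by
      have := hfar x hxs
      rw [sub_self, norm_zero] at this
      exact absurd (resolution_pos hG) this.not_gt
    have hs'G : ∀ c ∈ insert x s, ‖c‖ ≤ G := by
      intro c hc
      rcases Finset.mem_insert.1 hc with rfl | hc
      exacts [hx, hsG c hc]
    have hs'sep : ∀ c ∈ insert x s, ∀ c' ∈ insert x s, c ≠ c' → ε ≤ ‖c - c'‖ := by
      intro c hc c' hc' hne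
      rcases Finset.mem_insert.1 hc with rfl | hcs <;>
        rcases Finset.mem_insert.1 hc' with rfl | hcs'
      · exact absurd rfl hne
      · rw [norm_sub_rev]; exact (hfar c' hcs').le
      · exact (hfar c hcs).le
      · exact hsep c hcs c' hcs' hne
    have hle2 := card_le_two_pow_of_separated hd hG hle _ hs'G hs'sep
    have hgreat : (insert x s).card ≤ Nat.findGreatest p (2 ^ k) :=
      Nat.le_findGreatest hle2 ⟨_, rfl, hs'G, hs'sep⟩
    rw [Finset.card_insert_of_notMem hxs] at hgreat
    omega
  have hemb : Nonempty (s ↪ (Fin k → Bool)) :=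
    Function.Embedding.nonempty_of_card_le (by simpa using hs2)
  obtain ⟨e⟩ := hemb
  obtain ⟨c₀, hc₀, -⟩ := hcover 0 (by simpa using hG.le)
  have : Nonempty s := ⟨⟨c₀, hc₀⟩⟩
  choose! f hfs hf using hcover
  refine ⟨fun x => if hx : ‖x‖ ≤ G then e ⟨f x, hfs x hx⟩ else fun _ => true,
    fun w => (Function.invFun e w : s), fun x hx => ?_⟩
  simp only [hx, dif_pos, Function.leftInverse_invFun e.injective _]
  exact hf x hx

end Encoding

/-! ### Sequences with bounded delays -/

/-- The elements of `A` before `t`. -/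
def past (A : Finset ℕ) (t : ℕ) : Finset ℕ := A.filter (· < t)

theorem mem_past {A : Finset ℕ} {t s : ℕ} : s ∈ past A t ↔ s ∈ A ∧ s < t := by simp [past]

theorem past_succ_of_mem {A : Finset ℕ} {t : ℕ} (ht : t ∈ A) :
    past A (t + 1) = insert t (past A t) := by
  ext s
  simp only [mem_past, Finset.mem_insert]
  constructor
  · rintro ⟨h1, h2⟩
    rcases Nat.lt_succ_iff_lt_or_eq.1 h2 with h | h
    exacts [Or.inr ⟨h1, h⟩, Or.inl h]
  · rintro (rfl | ⟨h1, h2⟩)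
    exacts [⟨ht, by omega⟩, ⟨h1, by omega⟩]

theorem past_succ_of_notMem {A : Finset ℕ} {t : ℕ} (ht : t ∉ A) :
    past A (t + 1) = past A t := by
  ext s
  simp only [mem_past]
  constructor
  · rintro ⟨h1, h2⟩
    have : s ≠ t := fun h => ht (h ▸ h1)
    exact ⟨h1, by omega⟩
  · rintro ⟨h1, h2⟩
    exact ⟨h1, by omega⟩

theorem notMem_past_self (A : Finset ℕ) (t : ℕ) : t ∉ past A t := by simp [mem_past]

theorem sum_past_succ_of_mem {M : Type*} [AddCommMonoid M] {A : Finset ℕ} {t : ℕ} (ht : t ∈ A)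
    (f : ℕ → M) : ∑ s ∈ past A (t + 1), f s = ∑ s ∈ past A t, f s + f t := by
  rw [past_succ_of_mem ht, Finset.sum_insert (notMem_past_self A t), add_comm]

theorem past_eq_self {A : Finset ℕ} {T : ℕ} (hT : ∀ t ∈ A, t < T) : past A T = A :=
  Finset.filter_true_of_mem hT

theorem sum_le_sub_of_forall_le_sub {A : Finset ℕ} {c f : ℕ → ℝ}
    (h : ∀ t ∈ A, c t ≤ f (t + 1) - f t) (h' : ∀ t ∉ A, f (t + 1) = f t) (T : ℕ) :
    ∑ t ∈ past A T, c t ≤ f T - f 0 := by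
  induction T with
  | zero => simp [past]
  | succ T ih =>
    by_cases hT : T ∈ A
    · rw [sum_past_succ_of_mem hT]
      linarith [h T hT]
    · rw [past_succ_of_notMem hT, h' T hT]
      exact ih

/-- `A` is the set of rounds of a sequence of predictions; in round `t ∈ A` the earlier rounds of
`A` split into the set `S t` of those whose feedback is available and the set `γ t` of those whose
feedback is missing, and all missing feedback is less than `D` rounds old. -/
structure IsDelayed (A : Finset ℕ) (S γ : ℕ → Finset ℕ) (D : ℕ) : Prop where
  available_subset : ∀ t ∈ A, S t ⊆ past A t
  missing_eq : ∀ t ∈ A, γ t = past A t \ S t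
  lt_add : ∀ t ∈ A, ∀ i ∈ γ t, t < i + D

/-- The lag of the nonnegative numbers `a s` over all rounds of `A` before `t`. -/
def totalLag (A : Finset ℕ) (γ : ℕ → Finset ℕ) (a : ℕ → ℝ) (t : ℕ) : ℝ :=
  ∑ s ∈ past A t, (a s ^ 2 + 2 * a s * ∑ i ∈ γ s, a i)

/-- The part of the lag that is known in round `t`. -/
def knownLag (S γ : ℕ → Finset ℕ) (a : ℕ → ℝ) (t : ℕ) : ℝ :=
  ∑ s ∈ S t, (a s ^ 2 + 2 * a s * ∑ i ∈ γ s ∩ S t, a i)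

theorem totalLag_succ {A : Finset ℕ} {t : ℕ} (ht : t ∈ A) (γ : ℕ → Finset ℕ) (a : ℕ → ℝ) :
    totalLag A γ a (t + 1) = totalLag A γ a t + (a t ^ 2 + 2 * a t * ∑ i ∈ γ t, a i) :=
  sum_past_succ_of_mem ht _

theorem knownLag_nonneg (S γ : ℕ → Finset ℕ) {a : ℕ → ℝ} (ha : ∀ s, 0 ≤ a s) (t : ℕ) :
    0 ≤ knownLag S γ a t := by
  refine Finset.sum_nonneg fun s _ => ?_
  have h1 : 0 ≤ ∑ i ∈ γ s ∩ S t, a i := Finset.sum_nonneg fun i _ => ha i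
  have h2 := ha s
  positivity

namespace IsDelayed

variable {A : Finset ℕ} {S γ : ℕ → Finset ℕ} {D : ℕ}

theorem missing_subset (h : IsDelayed A S γ D) {t : ℕ} (ht : t ∈ A) : γ t ⊆ past A t := by
  rw [h.missing_eq t ht]; exact Finset.sdiff_subset

theorem mem_of_mem_missing (h : IsDelayed A S γ D) {t i : ℕ} (ht : t ∈ A) (hi : i ∈ γ t) :
    i ∈ A := (mem_past.1 (h.missing_subset ht hi)).1

theorem mem_of_mem_available (h : IsDelayed A S γ D) {t s : ℕ} (ht : t ∈ A) (hs : s ∈ S t) :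
    s ∈ A := (mem_past.1 (h.available_subset t ht hs)).1

theorem card_missing_le (h : IsDelayed A S γ D) {t : ℕ} (ht : t ∈ A) : (γ t).card ≤ D := by
  have : γ t ⊆ Finset.Ico (t - D) t := by
    intro i hi
    have h1 := h.lt_add t ht i hi
    have h2 := (mem_past.1 (h.missing_subset ht hi)).2
    simp; omega
  exact (Finset.card_le_card this).trans (by simp; omega)

theorem card_missing_from_le (h : IsDelayed A S γ D) (B : Finset ℕ) (hB : B ⊆ A) (i : ℕ) :
    (B.filter fun s => i ∈ γ s).card ≤ D := by
  have : (B.filter fun s => i ∈ γ s) ⊆ Finset.Ico i (i + D) := by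
    intro s hs
    obtain ⟨hs1, hs2⟩ := Finset.mem_filter.1 hs
    have h1 := h.lt_add s (hB hs1) i hs2
    have h2 := (mem_past.1 (h.missing_subset (hB hs1) hs2)).2
    simp; omega
  exact (Finset.card_le_card this).trans (by simp)

theorem sum_past_eq (h : IsDelayed A S γ D) {M : Type*} [AddCommMonoid M] {t : ℕ} (ht : t ∈ A)
    (f : ℕ → M) : ∑ s ∈ past A t, f s = ∑ s ∈ S t, f s + ∑ s ∈ γ t, f s := by
  rw [h.missing_eq t ht, add_comm, Finset.sum_sdiff (h.available_subset t ht)]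

variable {a : ℕ → ℝ} {B : ℝ}

theorem sum_missing_le (h : IsDelayed A S γ D) (hB : 0 ≤ B) (haB : ∀ t ∈ A, a t ≤ B)
    {t : ℕ} (ht : t ∈ A) : ∑ i ∈ γ t, a i ≤ D * B := by
  have h1 : ∑ i ∈ γ t, a i ≤ ∑ i ∈ γ t, B :=
    Finset.sum_le_sum fun i hi => haB i (h.mem_of_mem_missing ht hi)
  have h2 : ((γ t).card : ℝ) ≤ D := by exact_mod_cast h.card_missing_le ht
  simp only [Finset.sum_const, nsmul_eq_mul] at h1
  nlinarith

theorem sum_missing_nonneg (h : IsDelayed A S γ D) (ha : ∀ t ∈ A, 0 ≤ a t) {t : ℕ} (ht : t ∈ A) :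
    0 ≤ ∑ i ∈ γ t, a i :=
  Finset.sum_nonneg fun i hi => ha i (h.mem_of_mem_missing ht hi)

theorem lag_increment_nonneg (h : IsDelayed A S γ D) (ha : ∀ t ∈ A, 0 ≤ a t) {t : ℕ}
    (ht : t ∈ A) : 0 ≤ a t ^ 2 + 2 * a t * ∑ i ∈ γ t, a i := by
  have h1 := ha t ht
  have h2 := h.sum_missing_nonneg ha ht
  positivity

theorem totalLag_nonneg (h : IsDelayed A S γ D) (ha : ∀ t ∈ A, 0 ≤ a t) (t : ℕ) :
    0 ≤ totalLag A γ a t := by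
  exact Finset.sum_nonneg fun s hs => h.lag_increment_nonneg ha (mem_past.1 hs).1

theorem lag_increment_le (h : IsDelayed A S γ D) (hB : 0 ≤ B) (ha : ∀ t ∈ A, 0 ≤ a t)
    (haB : ∀ t ∈ A, a t ≤ B) {t : ℕ} (ht : t ∈ A) :
    a t ^ 2 + 2 * a t * ∑ i ∈ γ t, a i ≤ (1 + 2 * D) * B ^ 2 := by
  have h1 := ha t ht
  have h2 := haB t ht
  have h3 := h.sum_missing_le hB haB ht
  have h4 := h.sum_missing_nonneg ha ht
  have h5 : a t ^ 2 ≤ B ^ 2 := pow_le_pow_left₀ h1 h2 2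
  have h6 : a t * ∑ i ∈ γ t, a i ≤ B * (D * B) := mul_le_mul h2 h3 h4 hB
  nlinarith

theorem totalLag_sub_knownLag (h : IsDelayed A S γ D) {t : ℕ} (ht : t ∈ A) (a : ℕ → ℝ) :
    totalLag A γ a t - knownLag S γ a t =
      ∑ s ∈ γ t, (a s ^ 2 + 2 * a s * ∑ i ∈ γ s, a i) +
        ∑ s ∈ S t, 2 * a s * ∑ i ∈ γ s \ S t, a i := by
  have key : ∀ s, a s ^ 2 + 2 * a s * ∑ i ∈ γ s, a i =
      (a s ^ 2 + 2 * a s * ∑ i ∈ γ s ∩ S t, a i) + 2 * a s * ∑ i ∈ γ s \ S t, a i := by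
    intro s
    rw [← Finset.sum_inter_add_sum_sdiff (γ s) (S t) a]
    ring
  unfold totalLag knownLag
  rw [h.sum_past_eq ht, Finset.sum_congr rfl fun s _ => key s, Finset.sum_add_distrib]
  ring

theorem knownLag_le_totalLag (h : IsDelayed A S γ D) (ha : ∀ t ∈ A, 0 ≤ a t) {t : ℕ}
    (ht : t ∈ A) : knownLag S γ a t ≤ totalLag A γ a t := by
  rw [← sub_nonneg, h.totalLag_sub_knownLag ht]
  refine add_nonneg (Finset.sum_nonneg fun s hs => ?_) (Finset.sum_nonneg fun s hs => ?_)
  · have hs' := h.mem_of_mem_missing ht hs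
    have h1 := ha s hs'
    have h2 := h.sum_missing_nonneg ha hs'
    positivity
  · have hs' := h.mem_of_mem_available ht hs
    have h1 := ha s hs'
    have h2 : 0 ≤ ∑ i ∈ γ s \ S t, a i := Finset.sum_nonneg fun i hi =>
      ha i (h.mem_of_mem_missing hs' (Finset.mem_sdiff.1 hi).1)
    positivity

/-- The part of the lag that is unknown in round `t` is controlled by the missing feedback itself.
Each missing `i` occurs in it once by itself, against at most `D` terms that were missing in round
`i`, and in at most `D` rounds in which `i` was missing. -/
theorem totalLag_sub_knownLag_le (h : IsDelayed A S γ D) (hB : 0 ≤ B) (ha : ∀ t ∈ A, 0 ≤ a t)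
    (haB : ∀ t ∈ A, a t ≤ B) {t : ℕ} (ht : t ∈ A) :
    totalLag A γ a t - knownLag S γ a t ≤ (1 + 4 * D) * B * ∑ i ∈ γ t, a i := by
  rw [h.totalLag_sub_knownLag ht]
  have h1 : ∑ s ∈ γ t, (a s ^ 2 + 2 * a s * ∑ i ∈ γ s, a i) ≤
      ∑ s ∈ γ t, (1 + 2 * D) * B * a s := by
    refine Finset.sum_le_sum fun s hs => ?_
    have hs' := h.mem_of_mem_missing ht hs
    have e1 := ha s hs'
    have e2 := haB s hs'
    have e3 := h.sum_missing_le hB haB hs'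
    nlinarith
  have h2 : ∑ s ∈ S t, 2 * a s * ∑ i ∈ γ s \ S t, a i ≤
      ∑ s ∈ S t, ∑ i ∈ γ t, if i ∈ γ s then 2 * B * a i else 0 := by
    refine Finset.sum_le_sum fun s hs => ?_
    have hs' := h.mem_of_mem_available ht hs
    rw [← Finset.sum_filter, Finset.mul_sum]
    have hsub : γ s \ S t ⊆ (γ t).filter fun i => i ∈ γ s := by
      intro i hi
      obtain ⟨hi1, hi2⟩ := Finset.mem_sdiff.1 hi
      refine Finset.mem_filter.2 ⟨?_, hi1⟩
      rw [h.missing_eq t ht, Finset.mem_sdiff]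
      have e1 := mem_past.1 (h.missing_subset hs' hi1)
      have e2 := mem_past.1 (h.available_subset t ht hs)
      exact ⟨mem_past.2 ⟨e1.1, e1.2.trans e2.2⟩, hi2⟩
    refine (Finset.sum_le_sum (g := fun i => 2 * B * a i) fun i hi => ?_).trans
      (Finset.sum_le_sum_of_subset_of_nonneg hsub fun i hi _ => ?_)
    · have e1 := ha i (h.mem_of_mem_missing hs' (Finset.mem_sdiff.1 hi).1)
      have e2 := haB s hs'
      nlinarith
    · have e1 := ha i (h.mem_of_mem_missing ht (Finset.mem_filter.1 hi).1)
      positivity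
  have h3 : ∑ s ∈ S t, ∑ i ∈ γ t, (if i ∈ γ s then 2 * B * a i else 0) ≤
      ∑ i ∈ γ t, 2 * D * B * a i := by
    rw [Finset.sum_comm]
    refine Finset.sum_le_sum fun i hi => ?_
    rw [← Finset.sum_filter, Finset.sum_const, nsmul_eq_mul]
    have e1 := ha i (h.mem_of_mem_missing ht hi)
    have e2 : (((S t).filter fun s => i ∈ γ s).card : ℝ) ≤ D := by
      exact_mod_cast h.card_missing_from_le (S t) (fun s hs => h.mem_of_mem_available ht hs) i
    have e3 : 0 ≤ 2 * B * a i := by positivity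
    nlinarith
  rw [← Finset.mul_sum] at h1 h3
  nlinarith

end IsDelayed

/-! ### Projection onto the unit ball -/

section Projection

variable {d : ℕ}

theorem norm_projUnitBall_le (x : Vec d) : ‖projUnitBall x‖ ≤ 1 := by
  unfold projUnitBall
  have h : (0 : ℝ) < max 1 ‖x‖ := lt_max_of_lt_left one_pos
  rw [norm_smul, norm_inv, Real.norm_of_nonneg h.le, inv_mul_le_iff₀ h, mul_one]
  exact le_max_right _ _

theorem projUnitBall_of_norm_le {x : Vec d} (h : ‖x‖ ≤ 1) : projUnitBall x = x := by
  simp [projUnitBall, max_eq_left h]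

theorem projUnitBall_of_one_le {x : Vec d} (h : 1 ≤ ‖x‖) : projUnitBall x = ‖x‖⁻¹ • x := by
  simp [projUnitBall, max_eq_right h]

theorem inner_sub_projUnitBall_le {x z : Vec d} (hz : ‖z‖ ≤ 1) :
    inner ℝ (x - projUnitBall x) (z - projUnitBall x) ≤ 0 := by
  rcases le_total ‖x‖ 1 with h | h
  · simp [projUnitBall_of_norm_le h]
  · rw [projUnitBall_of_one_le h]
    have hx : 0 < ‖x‖ := by linarith
    have e1 : inner ℝ (x - ‖x‖⁻¹ • x) (z - ‖x‖⁻¹ • x) =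
        (1 - ‖x‖⁻¹) * (inner ℝ x z - ‖x‖) := by
      have : x - ‖x‖⁻¹ • x = (1 - ‖x‖⁻¹) • x := by rw [sub_smul, one_smul]
      rw [this, inner_smul_left, inner_sub_right, inner_smul_right, real_inner_self_eq_norm_sq]
      simp only [conj_trivial]
      field_simp
    have e2 : inner ℝ x z ≤ ‖x‖ :=
      (real_inner_le_norm x z).trans (mul_le_of_le_one_right hx.le hz)
    have e3 : ‖x‖⁻¹ ≤ 1 := inv_le_one_of_one_le₀ h
    rw [e1]
    exact mul_nonpos_of_nonneg_of_nonpos (by linarith) (by linarith)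

theorem norm_projUnitBall_sub_le (x y : Vec d) :
    ‖projUnitBall x - projUnitBall y‖ ≤ ‖x - y‖ := by
  set p := projUnitBall x
  set q := projUnitBall y
  have h1 : inner ℝ (x - p) (q - p) ≤ 0 := inner_sub_projUnitBall_le (norm_projUnitBall_le y)
  have h2 : inner ℝ (y - q) (p - q) ≤ 0 := inner_sub_projUnitBall_le (norm_projUnitBall_le x)
  have h3 : inner ℝ (x - y) (p - q) - inner ℝ (p - q) (p - q) =
      -(inner ℝ (x - p) (q - p) + inner ℝ (y - q) (p - q)) := by
    simp only [inner_sub_left, inner_sub_right]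
    ring
  have h4 := real_inner_le_norm (x - y) (p - q)
  rw [real_inner_self_eq_norm_sq] at h3
  have h5 : ‖p - q‖ * ‖p - q‖ ≤ ‖x - y‖ * ‖p - q‖ := by nlinarith
  rcases (norm_nonneg (p - q)).eq_or_lt with h | h
  · rw [← h]; positivity
  · exact le_of_mul_le_mul_right h5 h

/-- Changing the scale of a dual average moves its projection only by the relative change of the
scale, no matter how long the dual average is, because two long multiples of the same vector have
the same projection. -/
theorem norm_projUnitBall_smul_sub_le (x : Vec d) {η η' : ℝ} (hη' : 0 < η') (h : η' ≤ η) :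
    ‖projUnitBall (η • x) - projUnitBall (η' • x)‖ ≤ η / η' - 1 := by
  have hη : 0 < η := hη'.trans_le h
  have n1 : ‖η • x‖ = η * ‖x‖ := by rw [norm_smul, Real.norm_of_nonneg hη.le]
  have n2 : ‖η' • x‖ = η' * ‖x‖ := by rw [norm_smul, Real.norm_of_nonneg hη'.le]
  have hratio : 1 ≤ η / η' := (one_le_div hη').2 h
  rcases le_total 1 (η' * ‖x‖) with hx | hx
  · have hx0 : 0 < ‖x‖ := by
      by_contra! h0
      nlinarith
    have hx' : 1 ≤ η * ‖x‖ := hx.trans (mul_le_mul_of_nonneg_right h hx0.le)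
    rw [projUnitBall_of_one_le (n1 ▸ hx'), projUnitBall_of_one_le (n2 ▸ hx), n1, n2, smul_smul,
      smul_smul]
    have : (η * ‖x‖)⁻¹ * η = (η' * ‖x‖)⁻¹ * η' := by field_simp
    rw [this, sub_self, norm_zero]
    linarith
  · refine (norm_projUnitBall_sub_le _ _).trans ?_
    rw [← sub_smul, norm_smul, Real.norm_of_nonneg (by linarith), div_sub_one hη'.ne',
      le_div_iff₀ hη']
    nlinarith

end Projection

/-! ### Dual averaging with delayed feedback -/

section DualAveraging

variable {d : ℕ} {A : Finset ℕ}

/-- Strong convexity: away from its minimizer over the unit ball, the regularized linear loss grows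
quadratically. -/
theorem regularized_minimum {σ : ℝ} (hσ : 0 < σ) (θ z : Vec d) (hz : ‖z‖ ≤ 1) :
    let p := projUnitBall (-(σ⁻¹ • θ))
    inner ℝ θ p + σ / 2 * ‖p‖ ^ 2 + σ / 2 * ‖z - p‖ ^ 2 ≤ inner ℝ θ z + σ / 2 * ‖z‖ ^ 2 := by
  intro p
  have h : inner ℝ (-(σ⁻¹ • θ) - p) (z - p) ≤ 0 := inner_sub_projUnitBall_le hz
  have e : inner ℝ (-(σ⁻¹ • θ) - p) (z - p) =
      -σ⁻¹ * (inner ℝ θ z - inner ℝ θ p) - (inner ℝ z p - ‖p‖ ^ 2) := by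
    rw [inner_sub_left, inner_neg_left, inner_smul_left, inner_sub_right, inner_sub_right,
      real_inner_self_eq_norm_sq, real_inner_comm z p]
    simp only [conj_trivial]
    ring
  have e2 : ‖z - p‖ ^ 2 = ‖z‖ ^ 2 - 2 * inner ℝ z p + ‖p‖ ^ 2 := norm_sub_sq_real z p
  have h' : σ * (-σ⁻¹ * (inner ℝ θ z - inner ℝ θ p) - (inner ℝ z p - ‖p‖ ^ 2)) ≤ 0 :=
    mul_nonpos_of_nonneg_of_nonpos hσ.le (e ▸ h)
  have e3 : σ * (-σ⁻¹ * (inner ℝ θ z - inner ℝ θ p) - (inner ℝ z p - ‖p‖ ^ 2)) =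
      -(inner ℝ θ z - inner ℝ θ p) - σ * (inner ℝ z p - ‖p‖ ^ 2) := by
    field_simp
  rw [e2]
  linarith

/-- Regret of dual averaging over the unit ball with nondecreasing regularization `σ`, when the
feedback arrives immediately. -/
theorem dualAveraging_regret {σ : ℕ → ℝ} (hσ : ∀ t, 0 < σ t)
    (hmono : ∀ t, σ t ≤ σ (t + 1)) (hconst : ∀ t ∉ A, σ (t + 1) = σ t) (g : ℕ → Vec d) (T : ℕ)
    (u : Vec d) (hu : ‖u‖ ≤ 1) :
    ∑ t ∈ past A T, (inner ℝ (projUnitBall (-((σ t)⁻¹ • ∑ s ∈ past A t, g s)) - u) (g t)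
      - ‖g t‖ ^ 2 / (2 * σ t)) ≤ σ T / 2 := by
  set θ : ℕ → Vec d := fun t => ∑ s ∈ past A t, g s with hθ
  set z : ℕ → Vec d := fun t => projUnitBall (-((σ t)⁻¹ • θ t)) with hz
  let f : ℕ → ℝ := fun t => inner ℝ (θ t) (z t) + σ t / 2 * ‖z t‖ ^ 2
  have hstep : ∀ t ∈ A, inner ℝ (z t) (g t) - ‖g t‖ ^ 2 / (2 * σ t) ≤ f (t + 1) - f t := by
    intro t ht
    have e1 : θ (t + 1) = θ t + g t := sum_past_succ_of_mem ht g
    have e2 := regularized_minimum (hσ t) (θ t) (z (t + 1)) (norm_projUnitBall_le _)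
    change inner ℝ (θ t) (z t) + σ t / 2 * ‖z t‖ ^ 2 + σ t / 2 * ‖z (t + 1) - z t‖ ^ 2 ≤ _ at e2
    have e3 : -(‖g t‖ * ‖z (t + 1) - z t‖) ≤ inner ℝ (g t) (z (t + 1) - z t) :=
      neg_le_of_abs_le (abs_real_inner_le_norm _ _)
    have e4 : f (t + 1) = inner ℝ (θ t) (z (t + 1)) + inner ℝ (g t) (z (t + 1)) +
        σ (t + 1) / 2 * ‖z (t + 1)‖ ^ 2 := by
      simp only [f, e1, inner_add_left]
    have e5 : σ t / 2 * ‖z (t + 1)‖ ^ 2 ≤ σ (t + 1) / 2 * ‖z (t + 1)‖ ^ 2 := by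
      have := hmono t
      gcongr
    have e6 : ‖g t‖ * ‖z (t + 1) - z t‖ ≤
        σ t / 2 * ‖z (t + 1) - z t‖ ^ 2 + ‖g t‖ ^ 2 / (2 * σ t) := by
      have hs := hσ t
      have : σ t / 2 * ‖z (t + 1) - z t‖ ^ 2 + ‖g t‖ ^ 2 / (2 * σ t) -
          ‖g t‖ * ‖z (t + 1) - z t‖ = (σ t * ‖z (t + 1) - z t‖ - ‖g t‖) ^ 2 / (2 * σ t) := by
        field_simp
        ring
      have : 0 ≤ (σ t * ‖z (t + 1) - z t‖ - ‖g t‖) ^ 2 / (2 * σ t) := by positivity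
      linarith
    rw [inner_sub_right, real_inner_comm (z t) (g t)] at e3
    have e7 : f t = inner ℝ (θ t) (z t) + σ t / 2 * ‖z t‖ ^ 2 := rfl
    rw [e4, e7]
    linarith
  have hconst' : ∀ t ∉ A, f (t + 1) = f t := by
    intro t ht
    have e1 : θ (t + 1) = θ t := by simp only [hθ, past_succ_of_notMem ht]
    simp only [f, hz, e1, hconst t ht]
  have hsum := sum_le_sub_of_forall_le_sub hstep hconst' T
  have hf0 : f 0 = 0 := by
    have : θ 0 = 0 := by simp [hθ, past]
    simp [f, hz, this, projUnitBall]
  have hfT : f T ≤ inner ℝ (θ T) u + σ T / 2 := by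
    have e := regularized_minimum (hσ T) (θ T) u hu
    change inner ℝ (θ T) (z T) + σ T / 2 * ‖z T‖ ^ 2 + σ T / 2 * ‖u - z T‖ ^ 2 ≤ _ at e
    have hs := hσ T
    have e1 : 0 ≤ σ T / 2 * ‖u - z T‖ ^ 2 := by positivity
    have e2 : σ T / 2 * ‖u‖ ^ 2 ≤ σ T / 2 :=
      mul_le_of_le_one_right (by positivity) (pow_le_one₀ (norm_nonneg _) hu)
    simp only [f]
    linarith
  have hu' : ∑ t ∈ past A T, inner ℝ u (g t) = inner ℝ (θ T) u := by
    rw [real_inner_comm, hθ, inner_sum]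
  have hsplit : ∑ t ∈ past A T, (inner ℝ (z t - u) (g t) - ‖g t‖ ^ 2 / (2 * σ t)) =
      ∑ t ∈ past A T, (inner ℝ (z t) (g t) - ‖g t‖ ^ 2 / (2 * σ t)) -
        ∑ t ∈ past A T, inner ℝ u (g t) := by
    rw [← Finset.sum_sub_distrib]
    refine Finset.sum_congr rfl fun t _ => ?_
    rw [inner_sub_left]
    ring
  change ∑ t ∈ past A T, (inner ℝ (z t - u) (g t) - ‖g t‖ ^ 2 / (2 * σ t)) ≤ _
  rw [hsplit, hu']
  linarith

variable {S γ : ℕ → Finset ℕ} {D : ℕ}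

/-- AdaDelay-Dist stays close to dual averaging with all past gradients and the full lag. The
sum of the gradients changes by the missing ones, and the learning rate changes by a factor that is
controlled by the missing ones as well. -/
theorem norm_adaDelayDist_sub_le (h : IsDelayed A S γ D) {B : ℝ} (hB : 0 < B) (g : ℕ → Vec d)
    (hg : ∀ t ∈ A, ‖g t‖ ≤ B) {t : ℕ} (ht : t ∈ A) :
    ‖adaDelayDist D B S γ g t - projUnitBall (-((√(totalLag A γ (fun s => ‖g s‖) t
      + ((2 * (D : ℝ) + 1) * B) ^ 2))⁻¹ • ∑ s ∈ past A t, g s))‖ ≤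
      3 * (∑ i ∈ γ t, ‖g i‖) / √(totalLag A γ (fun s => ‖g s‖) t
        + ((2 * (D : ℝ) + 1) * B) ^ 2) := by
  set a : ℕ → ℝ := fun s => ‖g s‖ with ha
  have ha0 : ∀ t ∈ A, 0 ≤ a t := fun t _ => norm_nonneg _
  set β : ℝ := (2 * (D : ℝ) + 1) * B with hβ
  have hβ0 : 0 < β := by positivity
  set m : ℝ := ∑ i ∈ γ t, ‖g i‖ with hm
  have hm0 : 0 ≤ m := h.sum_missing_nonneg ha0 ht
  set σ := √(totalLag A γ a t + β ^ 2) with hσ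
  set ρ := √(knownLag S γ a t + β ^ 2) with hρ
  have hk0 : 0 ≤ knownLag S γ a t := knownLag_nonneg S γ (fun s => norm_nonneg _) t
  have hβρ : β ≤ ρ := Real.le_sqrt_of_sq_le (le_add_of_nonneg_left hk0)
  have hkt := h.knownLag_le_totalLag ha0 ht
  have hρσ : ρ ≤ σ := Real.sqrt_le_sqrt (by gcongr)
  have hρ0 : 0 < ρ := hβ0.trans_le hβρ
  have hσ0 : 0 < σ := hρ0.trans_le hρσ
  have hσ2 : σ ^ 2 = totalLag A γ a t + β ^ 2 :=
    Real.sq_sqrt (add_nonneg (hk0.trans hkt) (sq_nonneg β))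
  have hρ2 : ρ ^ 2 = knownLag S γ a t + β ^ 2 := Real.sq_sqrt (add_nonneg hk0 (sq_nonneg β))
  have hdiff : σ ^ 2 - ρ ^ 2 ≤ 2 * β * m := by
    have h1 := h.totalLag_sub_knownLag_le hB.le ha0 hg ht
    have h2 : (1 + 4 * D) * B * m ≤ 2 * β * m := by
      have : (1 + 4 * D) * B ≤ 2 * β := by rw [hβ]; nlinarith
      gcongr
    rw [hσ2, hρ2]
    change totalLag A γ a t - knownLag S γ a t ≤ (1 + 4 * D) * B * m at h1
    linarith
  have hz : adaDelayDist D B S γ g t = projUnitBall (ρ⁻¹ • (-∑ s ∈ S t, g s)) := by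
    rw [smul_neg]
    rfl
  rw [hz, ← smul_neg]
  have h1 : ‖projUnitBall (ρ⁻¹ • (-∑ s ∈ S t, g s)) - projUnitBall (σ⁻¹ • (-∑ s ∈ S t, g s))‖ ≤
      2 * m / σ := by
    refine (norm_projUnitBall_smul_sub_le _ (inv_pos.2 hσ0)
      (inv_anti₀ hρ0 hρσ)).trans ?_
    rw [inv_div_inv, div_sub_one hρ0.ne', div_le_div_iff₀ hρ0 hσ0]
    have e1 : (σ - ρ) * (σ + ρ) ≤ 2 * β * m := by nlinarith
    have e2 : β * m ≤ ρ * m := by gcongr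
    have e3 : (σ - ρ) * σ ≤ (σ - ρ) * (σ + ρ) :=
      mul_le_mul_of_nonneg_left (by linarith) (by linarith)
    linarith
  have h2 : ‖projUnitBall (σ⁻¹ • (-∑ s ∈ S t, g s)) - projUnitBall (σ⁻¹ • (-∑ s ∈ past A t, g s))‖
      ≤ m / σ := by
    refine (norm_projUnitBall_sub_le _ _).trans ?_
    rw [← smul_sub, h.sum_past_eq ht, norm_smul, norm_inv, Real.norm_of_nonneg hσ0.le,
      inv_mul_eq_div]
    have : -∑ s ∈ S t, g s - -(∑ s ∈ S t, g s + ∑ s ∈ γ t, g s) = ∑ s ∈ γ t, g s := by abel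
    rw [this]
    exact div_le_div_of_nonneg_right (norm_sum_le _ _) hσ0.le
  calc _ ≤ _ := norm_sub_le_norm_sub_add_norm_sub _
          (projUnitBall (σ⁻¹ • (-∑ s ∈ S t, g s))) _
    _ ≤ 2 * m / σ + m / σ := add_le_add h1 h2
    _ = 3 * m / σ := by ring

/-- Both the regret of the undelayed reference and the cost of staying close to it are sums of lag
increments divided by the square root of the lag, which telescope. -/
theorem adaDelayDist_regret (h : IsDelayed A S γ D) {B : ℝ} (hB : 0 < B) (g : ℕ → Vec d)
    (hg : ∀ t ∈ A, ‖g t‖ ≤ B) {T : ℕ} (hT : ∀ t ∈ A, t < T) (u : Vec d) (hu : ‖u‖ ≤ 1) :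
    ∑ t ∈ A, inner ℝ (adaDelayDist D B S γ g t - u) (g t) ≤
      5 * √(totalLag A γ (fun s => ‖g s‖) T + ((2 * (D : ℝ) + 1) * B) ^ 2) := by
  set a : ℕ → ℝ := fun s => ‖g s‖ with ha
  have ha0 : ∀ t ∈ A, 0 ≤ a t := fun t _ => norm_nonneg _
  set β : ℝ := (2 * (D : ℝ) + 1) * B with hβ
  have hβ0 : 0 < β := by positivity
  set σ : ℕ → ℝ := fun t => √(totalLag A γ a t + β ^ 2) with hσ
  have hσ2 : ∀ t, σ t ^ 2 = totalLag A γ a t + β ^ 2 := fun t =>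
    Real.sq_sqrt (add_nonneg (h.totalLag_nonneg ha0 t) (sq_nonneg β))
  have hσβ : ∀ t, β ≤ σ t := fun t =>
    Real.le_sqrt_of_sq_le (le_add_of_nonneg_left (h.totalLag_nonneg ha0 t))
  have hσ0 : ∀ t, 0 < σ t := fun t => hβ0.trans_le (hσβ t)
  have hconst : ∀ t ∉ A, σ (t + 1) = σ t := by
    intro t ht
    simp only [hσ, totalLag, past_succ_of_notMem ht]
  have hlag : ∀ t ∈ A, 0 ≤ a t ^ 2 + 2 * a t * ∑ i ∈ γ t, a i := fun t ht =>
    h.lag_increment_nonneg ha0 ht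
  have hmono : ∀ t, σ t ≤ σ (t + 1) := by
    intro t
    by_cases ht : t ∈ A
    · refine Real.sqrt_le_sqrt ?_
      rw [totalLag_succ ht]
      linarith [hlag t ht]
    · exact (hconst t ht).ge
  have hreg := dualAveraging_regret hσ0 hmono hconst g T u hu
  rw [past_eq_self hT] at hreg
  -- The increment of the lag is at most `β ^ 2`, so `σ` grows at most by a constant factor.
  have hincr : ∀ t ∈ A, (a t ^ 2 + 2 * a t * ∑ i ∈ γ t, a i) / σ t ≤
      5 / 2 * σ (t + 1) - 5 / 2 * σ t := by
    intro t ht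
    set l := a t ^ 2 + 2 * a t * ∑ i ∈ γ t, a i with hl
    have e1 : l ≤ (1 + 2 * D) * B ^ 2 := h.lag_increment_le hB.le ha0 hg ht
    have e2 : (1 + 2 * D) * B ^ 2 ≤ β ^ 2 := by
      rw [hβ]
      have : (0 : ℝ) ≤ D * B ^ 2 := by positivity
      have : (0 : ℝ) ≤ D ^ 2 * B ^ 2 := by positivity
      nlinarith
    have e3 : σ (t + 1) ^ 2 = σ t ^ 2 + l := by
      rw [hσ2, hσ2, totalLag_succ ht]; ring
    have e4 := hσβ t
    have e5 := hσ0 t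
    have e6 : σ (t + 1) ≤ 3 / 2 * σ t := by
      refine (sq_le_sq₀ (hσ0 _).le (by positivity)).1 ?_
      nlinarith
    have e7 := hmono t
    rw [div_le_iff₀ e5]
    have e8 : l = (σ (t + 1) - σ t) * (σ (t + 1) + σ t) := by
      linarith [sq_sub_sq (σ (t + 1)) (σ t)]
    rw [e8]
    nlinarith
  have htele := sum_le_sub_of_forall_le_sub (f := fun t => 5 / 2 * σ t) hincr
    (fun t ht => by simp only [hconst t ht]) T
  rw [past_eq_self hT] at htele
  have hterm : ∀ t ∈ A, inner ℝ (adaDelayDist D B S γ g t - u) (g t) ≤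
      (inner ℝ (projUnitBall (-((σ t)⁻¹ • ∑ s ∈ past A t, g s)) - u) (g t)
        - ‖g t‖ ^ 2 / (2 * σ t)) +
      3 / 2 * ((a t ^ 2 + 2 * a t * ∑ i ∈ γ t, a i) / σ t) := by
    intro t ht
    set z' := projUnitBall (-((σ t)⁻¹ • ∑ s ∈ past A t, g s))
    have e1 : ‖adaDelayDist D B S γ g t - z'‖ ≤ 3 * (∑ i ∈ γ t, a i) / σ t :=
      norm_adaDelayDist_sub_le h hB g hg ht
    have e2 : inner ℝ (adaDelayDist D B S γ g t - z') (g t) ≤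
        3 * (∑ i ∈ γ t, a i) / σ t * a t :=
      (real_inner_le_norm _ _).trans (mul_le_mul_of_nonneg_right e1 (norm_nonneg _))
    have e3 : inner ℝ (adaDelayDist D B S γ g t - u) (g t) =
        inner ℝ (adaDelayDist D B S γ g t - z') (g t) + inner ℝ (z' - u) (g t) := by
      rw [← inner_add_left, sub_add_sub_cancel]
    have e4 : 3 / 2 * ((a t ^ 2 + 2 * a t * ∑ i ∈ γ t, a i) / σ t) =
        3 * (∑ i ∈ γ t, a i) / σ t * a t + 3 * (‖g t‖ ^ 2 / (2 * σ t)) := by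
      have := hσ0 t
      simp only [ha]
      field_simp
      ring
    have e5 : 0 ≤ ‖g t‖ ^ 2 / (2 * σ t) := by have := hσ0 t; positivity
    rw [e3, e4]
    linarith
  have hsum := Finset.sum_le_sum hterm
  rw [Finset.sum_add_distrib, ← Finset.mul_sum] at hsum
  change _ ≤ 5 * σ T
  have := hσ0 0
  have := hσ0 T
  linarith

end DualAveraging

/-! ### The one-dimensional algorithm -/

section Potential

/-- One step of the potential argument, after division by the value of the exponential that the
learner knows. Here `y` is the scaled new loss, `m` the sum of the scaled missing losses and `b`
the unknown part of the exponent; the second-order terms `y ^ 2` and `2 * |y| * m` absorb the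
curvature of the exponential and the effect of the delay. -/
theorem le_exp_neg_mul_one_sub_exp {y m b : ℝ} (hy : |y| ≤ 1 / 20) (hm : 0 ≤ m) (hm' : m ≤ 1 / 40)
    (hb : |b| ≤ 11 / 10 * m) :
    y ≤ Real.exp (-b) * (1 - Real.exp (-(y + y ^ 2 + 2 * |y| * m))) := by
  have hy0 := abs_nonneg y
  have hysq : y ^ 2 = |y| ^ 2 := (sq_abs y).symm
  set w := y + y ^ 2 + 2 * |y| * m with hw
  have hw1 : |w| ≤ 11 / 10 * |y| := by
    have e1 : |w| ≤ |y| + |y ^ 2| + |2 * |y| * m| := abs_add_three _ _ _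
    have e2 : |y ^ 2| = |y| ^ 2 := abs_pow y 2
    have e3 : |2 * |y| * m| = 2 * |y| * m := abs_of_nonneg (by positivity)
    rw [e2, e3] at e1
    nlinarith
  have hw2 : w ^ 2 ≤ 121 / 100 * y ^ 2 := by
    rw [← sq_abs w, hysq]
    nlinarith [abs_nonneg w]
  have hexp : Real.exp (-w) ≤ 1 - w + 53 / 100 * w ^ 2 := by
    have hle : |-w| ≤ 1 := by rw [abs_neg]; linarith
    have h := Real.exp_bound hle (n := 3) (by norm_num)
    simp only [Finset.sum_range_succ, Finset.sum_range_zero, Nat.factorial] at h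
    have h' := (abs_le.1 h).2
    norm_num at h'
    have e : |w| ^ 3 ≤ 1 / 10 * w ^ 2 := by
      rw [← sq_abs w]
      have : |w| ≤ 1 / 10 := by linarith
      nlinarith [abs_nonneg w, sq_nonneg |w|]
    nlinarith [sq_nonneg w]
  have hone : y + 2 * |y| * m ≤ 1 - Real.exp (-w) := by
    nlinarith [sq_nonneg y]
  have hbm := abs_le.1 hb
  have hpos := Real.exp_pos (-b)
  refine le_trans ?_ (mul_le_mul_of_nonneg_left hone hpos.le)
  rcases le_total 0 y with h | h
  · rw [abs_of_nonneg h]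
    have e1 : 1 - 11 / 10 * m ≤ Real.exp (-b) := by
      linarith [Real.add_one_le_exp (-b)]
    have e2 : 0 ≤ y + 2 * y * m := by positivity
    have e3 : (1 - 11 / 10 * m) * (y + 2 * y * m) ≤ Real.exp (-b) * (y + 2 * y * m) :=
      mul_le_mul_of_nonneg_right e1 e2
    have e4 : 0 ≤ y * m := by positivity
    nlinarith
  · rw [abs_of_nonpos h]
    have e1 : 1 - 2 * m ≤ Real.exp b := by linarith [Real.add_one_le_exp b]
    have e2 : Real.exp (-b) * (1 - 2 * m) ≤ 1 := by
      have := mul_le_mul_of_nonneg_left e1 hpos.le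
      rwa [← Real.exp_add, neg_add_cancel, Real.exp_zero] at this
    nlinarith

variable {A : Finset ℕ} {S γ : ℕ → Finset ℕ} {D : ℕ} {x : ℕ → ℝ} {M : ℝ}

/-- The potential `exp (-η ∑ x - η² lag)` over all rounds of `A` before `t`. -/
noncomputable def potential (A : Finset ℕ) (γ : ℕ → Finset ℕ) (x : ℕ → ℝ) (η : ℝ) (t : ℕ) : ℝ :=
  Real.exp (-(η * ∑ s ∈ past A t, x s + η ^ 2 * totalLag A γ (fun s => |x s|) t))

/-- The part of the potential that is known in round `t`. -/
noncomputable def knownPotential (S γ : ℕ → Finset ℕ) (x : ℕ → ℝ) (η : ℝ) (t : ℕ) : ℝ :=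
  Real.exp (-(η * ∑ s ∈ S t, x s + η ^ 2 * knownLag S γ (fun s => |x s|) t))

theorem mul_knownPotential_le (h : IsDelayed A S γ D) (hM : 0 < M) (hx : ∀ t ∈ A, |x t| ≤ M)
    {η : ℝ} (hη : 0 ≤ η) (hη' : η ≤ (M * 20 * (1 + 2 * (D : ℝ)))⁻¹) {t : ℕ} (ht : t ∈ A) :
    η * x t * knownPotential S γ x η t ≤ potential A γ x η t - potential A γ x η (t + 1) := by
  set a : ℕ → ℝ := fun s => |x s| with ha
  have ha0 : ∀ t ∈ A, 0 ≤ a t := fun t _ => abs_nonneg _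
  have hηM : η * M * (20 * (1 + 2 * (D : ℝ))) ≤ 1 := by
    have hpos : 0 < M * 20 * (1 + 2 * (D : ℝ)) := by positivity
    have := mul_le_mul_of_nonneg_right hη' hpos.le
    rw [inv_mul_cancel₀ hpos.ne'] at this
    linarith
  have hηM0 : 0 ≤ η * M := by positivity
  have hηMD0 : 0 ≤ η * M * D := by positivity
  set m0 := ∑ i ∈ γ t, a i with hm0
  have hm00 : 0 ≤ m0 := h.sum_missing_nonneg ha0 ht
  have hm0le : m0 ≤ D * M := h.sum_missing_le hM.le hx ht
  set K := knownLag S γ a t with hK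
  set Λ := totalLag A γ a t with hΛ
  have hd1 : K ≤ Λ := h.knownLag_le_totalLag ha0 ht
  have hd2 : Λ - K ≤ (1 + 4 * D) * M * m0 := h.totalLag_sub_knownLag_le hM.le ha0 hx ht
  set b := η * ∑ s ∈ γ t, x s + η ^ 2 * (Λ - K) with hb
  have hbabs : |b| ≤ 11 / 10 * (η * m0) := by
    have e1 : |b| ≤ |η * ∑ s ∈ γ t, x s| + |η ^ 2 * (Λ - K)| := abs_add_le _ _
    have e2 : |η * ∑ s ∈ γ t, x s| ≤ η * m0 := by
      rw [abs_mul, abs_of_nonneg hη]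
      exact mul_le_mul_of_nonneg_left (Finset.abs_sum_le_sum_abs _ _) hη
    have e3 : |η ^ 2 * (Λ - K)| ≤ η ^ 2 * ((1 + 4 * D) * M * m0) := by
      rw [abs_of_nonneg (mul_nonneg (sq_nonneg _) (by linarith))]
      exact mul_le_mul_of_nonneg_left hd2 (sq_nonneg _)
    have e4 : η ^ 2 * ((1 + 4 * D) * M * m0) = (η * m0) * (η * M + 4 * (η * M * D)) := by ring
    have e5 : η * M + 4 * (η * M * D) ≤ 1 / 10 := by linarith
    have e6 : (η * m0) * (η * M + 4 * (η * M * D)) ≤ (η * m0) * (1 / 10) :=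
      mul_le_mul_of_nonneg_left e5 (by positivity)
    linarith
  have hy : |η * x t| ≤ 1 / 20 := by
    rw [abs_mul, abs_of_nonneg hη]
    have := mul_le_mul_of_nonneg_left (hx t ht) hη
    linarith
  have hm : η * m0 ≤ 1 / 40 := by
    have := mul_le_mul_of_nonneg_left hm0le hη
    linarith
  have key := le_exp_neg_mul_one_sub_exp hy (by positivity : 0 ≤ η * m0) hm hbabs
  have e1 : potential A γ x η t = knownPotential S γ x η t * Real.exp (-b) := by
    unfold potential knownPotential
    rw [← Real.exp_add, h.sum_past_eq ht]
    congr 1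
    change -(η * (∑ s ∈ S t, x s + ∑ s ∈ γ t, x s) + η ^ 2 * Λ) =
      -(η * ∑ s ∈ S t, x s + η ^ 2 * K) + -b
    rw [hb]; ring
  have e2 : potential A γ x η (t + 1) = potential A γ x η t *
      Real.exp (-(η * x t + (η * x t) ^ 2 + 2 * |η * x t| * (η * m0))) := by
    unfold potential
    rw [← Real.exp_add, sum_past_succ_of_mem ht, totalLag_succ ht]
    congr 1
    change -(η * (∑ s ∈ past A t, x s + x t) + η ^ 2 * (Λ + (|x t| ^ 2 + 2 * |x t| * m0))) =
      -(η * ∑ s ∈ past A t, x s + η ^ 2 * Λ) + _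
    rw [abs_mul, abs_of_nonneg hη, sq_abs]; ring
  have hq : 0 < knownPotential S γ x η t := Real.exp_pos _
  rw [e2, e1]
  have := mul_le_mul_of_nonneg_left key hq.le
  linarith

theorem continuous_potential (t : ℕ) : Continuous fun η => potential A γ x η t := by
  unfold potential; fun_prop

theorem continuous_knownPotential (t : ℕ) : Continuous fun η => knownPotential S γ x η t := by
  unfold knownPotential; fun_prop

theorem scalePrediction_eq (ν : ℝ) (D : ℕ) (B ε : ℝ) (S γ : ℕ → Finset ℕ) (h : ℕ → ℝ) (t : ℕ) :
    scalePrediction ν D B ε S γ h t =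
      (∫ η in (0 : ℝ)..((B + ε) * 20 * (1 + 2 * (D : ℝ)))⁻¹,
        ν * knownPotential S γ (fun s => h s + ε) η t * η * Real.exp (-η ^ 2)) /
      ∫ η in (0 : ℝ)..((B + ε) * 20 * (1 + 2 * (D : ℝ)))⁻¹, Real.exp (-η ^ 2) := by
  unfold scalePrediction
  simp only
  congr 2
  ext η
  congr 4
  unfold knownLag lagCorrection
  congr 1
  rw [Finset.mul_sum, Finset.mul_sum, ← Finset.sum_add_distrib]
  refine Finset.sum_congr rfl fun s _ => ?_
  rw [sq_abs]
  ring

theorem scalePrediction_nonneg {ν : ℝ} (hν : 0 ≤ ν) (D : ℕ) {B ε : ℝ} (hB : 0 < B + ε)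
    (S γ : ℕ → Finset ℕ) (h : ℕ → ℝ) (t : ℕ) : 0 ≤ scalePrediction ν D B ε S γ h t := by
  rw [scalePrediction_eq]
  have ha : 0 ≤ ((B + ε) * 20 * (1 + 2 * (D : ℝ)))⁻¹ := by positivity
  refine div_nonneg (intervalIntegral.integral_nonneg ha fun η hη => ?_)
    (intervalIntegral.integral_nonneg ha fun η _ => (Real.exp_pos _).le)
  have h1 : 0 ≤ knownPotential S γ (fun s => h s + ε) η t := (Real.exp_pos _).le
  have h2 := hη.1
  positivity

theorem integral_exp_neg_sq_pos {a : ℝ} (ha : 0 < a) :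
    0 < ∫ η in (0 : ℝ)..a, Real.exp (-η ^ 2) :=
  intervalIntegral.intervalIntegral_pos_of_pos
    ((by fun_prop : Continuous fun η : ℝ => Real.exp (-η ^ 2)).intervalIntegrable _ _)
    (fun _ => Real.exp_pos _) ha

theorem integral_exp_neg_sq_le {a : ℝ} (ha : 0 ≤ a) :
    ∫ η in (0 : ℝ)..a, Real.exp (-η ^ 2) ≤ a := by
  have h : ∫ η in (0 : ℝ)..a, Real.exp (-η ^ 2) ≤ ∫ _ in (0 : ℝ)..a, (1 : ℝ) := by
    refine intervalIntegral.integral_mono_on ha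
      ((by fun_prop : Continuous fun η : ℝ => Real.exp (-η ^ 2)).intervalIntegrable _ _)
      (continuous_const.intervalIntegrable _ _) fun η _ => ?_
    exact Real.exp_le_one_iff.2 (neg_nonpos.2 (sq_nonneg η))
  simpa using h

theorem integral_exp_neg_sq_le_two {a : ℝ} (ha : 0 ≤ a) :
    ∫ η in (0 : ℝ)..a, Real.exp (-η ^ 2) ≤ 2 := by
  have hc : Continuous fun η : ℝ => (1 + η ^ 2)⁻¹ :=
    Continuous.inv₀ (by fun_prop) fun η => by positivity
  have h : ∫ η in (0 : ℝ)..a, Real.exp (-η ^ 2) ≤ ∫ η in (0 : ℝ)..a, (1 + η ^ 2)⁻¹ := by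
    refine intervalIntegral.integral_mono_on ha
      ((by fun_prop : Continuous fun η : ℝ => Real.exp (-η ^ 2)).intervalIntegrable _ _)
      (hc.intervalIntegrable _ _) fun η _ => ?_
    rw [Real.exp_neg]
    exact inv_anti₀ (by positivity) (by linarith [Real.add_one_le_exp (η ^ 2)])
  rw [integral_inv_one_add_sq, Real.arctan_zero, sub_zero] at h
  linarith [Real.arctan_lt_pi_div_two a, Real.pi_lt_four]

/-- The cumulative loss of the one-dimensional algorithm is at most `ν` times the decrease of the
expected potential. -/
theorem sum_scalePrediction_mul_le (h : IsDelayed A S γ D) {ν B ε : ℝ} (hν : 0 ≤ ν)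
    (hB : 0 < B + ε) (l : ℕ → ℝ) (hx : ∀ t ∈ A, |l t + ε| ≤ B + ε) {T : ℕ}
    (hT : ∀ t ∈ A, t < T) :
    ∑ t ∈ A, scalePrediction ν D B ε S γ l t * (l t + ε) ≤
      ν - ν * ((∫ η in (0 : ℝ)..((B + ε) * 20 * (1 + 2 * (D : ℝ)))⁻¹,
        potential A γ (fun s => l s + ε) η T * Real.exp (-η ^ 2)) /
      ∫ η in (0 : ℝ)..((B + ε) * 20 * (1 + 2 * (D : ℝ)))⁻¹, Real.exp (-η ^ 2)) := by
  set a := ((B + ε) * 20 * (1 + 2 * (D : ℝ)))⁻¹ with ha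
  have ha0 : 0 < a := by positivity
  set Z := ∫ η in (0 : ℝ)..a, Real.exp (-η ^ 2) with hZ
  have hZ0 : 0 < Z := integral_exp_neg_sq_pos ha0
  set x : ℕ → ℝ := fun s => l s + ε with hxdef
  let f : ℕ → ℝ := fun t => -(ν * ((∫ η in (0 : ℝ)..a,
    potential A γ x η t * Real.exp (-η ^ 2)) / Z))
  have hint : ∀ t, IntervalIntegrable (fun η => potential A γ x η t * Real.exp (-η ^ 2))
      MeasureTheory.volume 0 a := fun t =>
    ((continuous_potential t).mul (by fun_prop)).intervalIntegrable _ _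
  have hstep : ∀ t ∈ A, scalePrediction ν D B ε S γ l t * (l t + ε) ≤ f (t + 1) - f t := by
    intro t ht
    have e1 : scalePrediction ν D B ε S γ l t * (l t + ε) = ν * ((∫ η in (0 : ℝ)..a,
        η * x t * knownPotential S γ x η t * Real.exp (-η ^ 2)) / Z) := by
      rw [scalePrediction_eq, div_mul_eq_mul_div, ← intervalIntegral.integral_mul_const,
        ← mul_div_assoc, ← intervalIntegral.integral_const_mul]
      congr 2
      ext η
      simp only [hxdef]
      ring
    have e2 : (∫ η in (0 : ℝ)..a, η * x t * knownPotential S γ x η t * Real.exp (-η ^ 2)) ≤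
        ∫ η in (0 : ℝ)..a, (potential A γ x η t * Real.exp (-η ^ 2) -
          potential A γ x η (t + 1) * Real.exp (-η ^ 2)) := by
      refine intervalIntegral.integral_mono_on ha0.le ?_ ((hint t).sub (hint (t + 1)))
        fun η hη => ?_
      · exact (((by fun_prop : Continuous fun η : ℝ => η * x t).mul
          (continuous_knownPotential t)).mul (by fun_prop)).intervalIntegrable _ _
      · rw [← sub_mul]
        exact mul_le_mul_of_nonneg_right (mul_knownPotential_le h hB hx hη.1 hη.2 ht)
          (Real.exp_pos _).le
    rw [intervalIntegral.integral_sub (hint t) (hint (t + 1))] at e2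
    have e3 := mul_le_mul_of_nonneg_left (div_le_div_of_nonneg_right e2 hZ0.le) hν
    rw [e1]
    refine e3.trans (le_of_eq ?_)
    simp only [f]
    ring
  have hconst : ∀ t ∉ A, f (t + 1) = f t := by
    intro t ht
    simp only [f, potential, totalLag, past_succ_of_notMem ht]
  have hsum := sum_le_sub_of_forall_le_sub hstep hconst T
  rw [past_eq_self hT] at hsum
  have hf0 : f 0 = -ν := by
    have : ∀ η, potential A γ x η 0 = 1 := fun η => by simp [potential, totalLag, past]
    simp only [f, this, one_mul]
    rw [div_self hZ0.ne', mul_one]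
  rw [hf0] at hsum
  simp only [f] at hsum
  linarith

end Potential

section Tuning

/-- Lower bound on the potential around a good value `η₀` of the learning rate. -/
theorem le_integral_exp {a Y V η₀ : ℝ} (hη₀ : 0 < η₀) (ha : η₀ ≤ a) (hY : 0 ≤ Y)
    (hV : 2 * V * η₀ ≤ Y) :
    η₀ / 2 * Real.exp (3 / 8 * (η₀ * Y)) ≤ ∫ η in (0 : ℝ)..a, Real.exp (η * Y - η ^ 2 * V) := by
  have hc : Continuous fun η : ℝ => Real.exp (η * Y - η ^ 2 * V) := by fun_prop
  have h1 : ∫ η in (η₀ / 2)..η₀, Real.exp (η * Y - η ^ 2 * V) ≤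
      ∫ η in (0 : ℝ)..a, Real.exp (η * Y - η ^ 2 * V) :=
    intervalIntegral.integral_mono_interval (by positivity) (by linarith) ha
      (Filter.Eventually.of_forall fun _ => (Real.exp_pos _).le) (hc.intervalIntegrable _ _)
  refine le_trans ?_ h1
  have h2 : ∫ _ in (η₀ / 2)..η₀, Real.exp (3 / 8 * (η₀ * Y)) ≤
      ∫ η in (η₀ / 2)..η₀, Real.exp (η * Y - η ^ 2 * V) := by
    refine intervalIntegral.integral_mono_on (by linarith) (continuous_const.intervalIntegrable _ _)
      (hc.intervalIntegrable _ _) fun η hη => Real.exp_le_exp.2 ?_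
    obtain ⟨l1, l2⟩ := hη
    have e1 : η ^ 2 * (2 * V * η₀) ≤ η ^ 2 * Y := mul_le_mul_of_nonneg_left hV (sq_nonneg _)
    have e2 : 0 ≤ Y * ((η - η₀ / 2) * (3 / 2 * η₀ - η)) :=
      mul_nonneg hY (mul_nonneg (by linarith) (by linarith))
    have e3 : η₀ * (3 / 8 * (η₀ * Y)) ≤ η₀ * (η * Y - η ^ 2 * V) := by nlinarith
    exact le_of_mul_le_mul_left e3 hη₀
  have h3 : ∫ _ in (η₀ / 2)..η₀, Real.exp (3 / 8 * (η₀ * Y)) =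
      η₀ / 2 * Real.exp (3 / 8 * (η₀ * Y)) := by
    rw [intervalIntegral.integral_const, smul_eq_mul]
    ring
  linarith

theorem two_pow_mul_le_exp {L : ℝ} (hL : Real.log 2 ≤ L) (j : ℕ) {c : ℝ}
    (hc : (j + 1 : ℝ) * L ≤ c) :
    2 ^ j * Real.exp L ≤ Real.exp c := by
  have h1 : (2 : ℝ) ^ j = Real.exp (j * Real.log 2) := by
    rw [Real.exp_nat_mul, Real.exp_log two_pos]
  rw [h1, ← Real.exp_add, Real.exp_le_exp]
  have : (j : ℝ) * Real.log 2 ≤ j * L := by gcongr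
  linarith

/-- If the cumulative gain `Y` exceeds the claimed bound, the comparator's gain `U * Y` is paid for
by the expected potential. Depending on whether the optimal learning rate `Y / (2 V)` exceeds the
end `a` of the range, the exponent is of the order of `Y / (M D)` or of `Y ^ 2 / V`. Either way it
exceeds a multiple of `L` large enough for a power of `exp L ≥ 2` to absorb the numerical constants;
the factor `800` is chosen for this. -/
theorem mul_le_integral_div {N U G M L Y V Z a : ℝ} {D n : ℕ} (hD : 1 ≤ D) (hN : 0 ≤ N)
    (hU : 0 ≤ U) (hG : 0 < G) (hM : 0 < M) (hMG : M ≤ 7 * G)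
    (hR : 1 ≤ N * D * U * n * G) (hL : L = Real.log (1 + N * D * U * n * G))
    (hV1 : 1 ≤ V) (hV : V ≤ 1 + n * ((1 + 2 * D) * M ^ 2)) (hYn : Y ≤ n * M)
    (ha : a = (M * 20 * (1 + 2 * (D : ℝ)))⁻¹) (hZ0 : 0 < Z) (hZa : Z ≤ a) (hZ2 : Z ≤ 2)
    (hY : 800 * (√(V * L) + M * D * L) < Y) :
    N * (U * Y) ≤ (∫ η in (0 : ℝ)..a, Real.exp (η * Y - η ^ 2 * V)) / Z := by
  have hD' : (1 : ℝ) ≤ D := by exact_mod_cast hD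
  have ha0 : 0 < a := by rw [ha]; positivity
  have haM : a * M * (20 * (1 + 2 * D)) = 1 := by
    rw [ha]; field_simp
  have haMD : 1 ≤ 60 * (a * M * D) := by
    have : 0 < a * M := by positivity
    nlinarith
  have hL2 : Real.log 2 ≤ L := by
    rw [hL]; exact Real.log_le_log two_pos (by linarith)
  have hlog2 : (0.69 : ℝ) < Real.log 2 := lt_trans (by norm_num) Real.log_two_gt_d9
  have hL0 : 0.69 < L := hlog2.trans_le hL2
  have hexpL : Real.exp L = 1 + N * D * U * n * G := by
    rw [hL, Real.exp_log (by linarith)]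
  have hNU : N * U * (n * G) ≤ Real.exp L := by
    rw [hexpL]
    have : 0 ≤ N * U * (n * G) := by positivity
    nlinarith
  have hsqrt : 0 ≤ √(V * L) := Real.sqrt_nonneg _
  have hMDL : 0 < M * D * L := by positivity
  have hY0 : 0 < Y := by linarith
  rw [le_div_iff₀ hZ0]
  rcases le_total (a * (2 * V)) Y with hcase | hcase
  · refine le_trans ?_ (le_integral_exp ha0 le_rfl hY0.le (by linarith))
    have e1 : 14 * Real.exp L ≤ Real.exp (3 / 8 * (a * Y)) := by
      refine le_trans ?_ (two_pow_mul_le_exp hL2 4 (c := 3 / 8 * (a * Y)) ?_)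
      · have := Real.exp_pos L
        linarith
      · have e2 : a * (800 * (M * D * L)) ≤ a * Y :=
          mul_le_mul_of_nonneg_left (by linarith) ha0.le
        have e3 : 1 * L ≤ 60 * (a * M * D) * L := mul_le_mul_of_nonneg_right haMD (by linarith)
        norm_num
        linarith
    have e2 : N * (U * Y) ≤ 7 * Real.exp L := by
      have : Y ≤ 7 * (n * G) := by
        have := mul_le_mul_of_nonneg_left hMG (Nat.cast_nonneg (α := ℝ) n)
        linarith
      have := mul_le_mul_of_nonneg_left this (mul_nonneg hN hU)
      linarith
    have e3 : N * (U * Y) * Z ≤ 7 * Real.exp L * a :=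
      mul_le_mul e2 hZa hZ0.le (by positivity)
    have e4 := mul_le_mul_of_nonneg_left e1 ha0.le
    linarith
  · have hη0 : 0 < Y / (2 * V) := by positivity
    have hηa : Y / (2 * V) ≤ a := by
      rw [div_le_iff₀ (by positivity)]; exact hcase
    refine le_trans ?_ (le_integral_exp hη0 hηa hY0.le (by field_simp; rfl))
    have hYsq : 800 ^ 2 * (V * L) ≤ Y ^ 2 := by
      have e1 : 800 * √(V * L) ≤ Y := by linarith
      have e2 := pow_le_pow_left₀ (by positivity) e1 2
      rwa [mul_pow, Real.sq_sqrt (by positivity)] at e2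
    have hexp : 60 * Real.exp L ≤ Real.exp (3 / 8 * (Y / (2 * V) * Y)) := by
      refine le_trans ?_ (two_pow_mul_le_exp hL2 6 (c := 3 / 8 * (Y / (2 * V) * Y)) ?_)
      · have := Real.exp_pos L
        linarith
      · have : 3 / 8 * (Y / (2 * V) * Y) = 3 / 16 * Y ^ 2 / V := by field_simp; ring
        rw [this, le_div_iff₀ (by positivity)]
        norm_num
        nlinarith
    -- A large `Y` forces `n * G` to be bounded below, which is needed when `G` is small.
    have hnG : 1 ≤ 7 * (n * G) := by
      have e1 : 1 ≤ Y := by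
        have : 1 ≤ 800 ^ 2 * (V * L) := by nlinarith
        nlinarith
      have := mul_le_mul_of_nonneg_left hMG (Nat.cast_nonneg (α := ℝ) n)
      linarith
    have hVZ : V * Z ≤ 15 * (n * G) := by
      have e1 : V * Z ≤ (1 + n * ((1 + 2 * D) * M ^ 2)) * Z := mul_le_mul_of_nonneg_right hV hZ0.le
      have e2 : n * ((1 + 2 * D) * M ^ 2) * Z ≤ n * ((1 + 2 * D) * M ^ 2) * a :=
        mul_le_mul_of_nonneg_left hZa (by positivity)
      have e3 : n * ((1 + 2 * D) * M ^ 2) * a = n * M / 20 * (a * M * (20 * (1 + 2 * D))) := by ring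
      rw [haM] at e3
      have e4 := mul_le_mul_of_nonneg_left hMG (Nat.cast_nonneg (α := ℝ) n)
      linarith
    have e1 : N * U * (4 * (V * Z)) ≤ Real.exp (3 / 8 * (Y / (2 * V) * Y)) := by
      have := mul_le_mul_of_nonneg_left hVZ (mul_nonneg hN hU)
      linarith
    have e2 : N * (U * Y) * Z = Y / (2 * V) / 2 * (N * U * (4 * (V * Z))) := by
      field_simp
      ring
    rw [e2]
    exact mul_le_mul_of_nonneg_left e1 (by positivity)

variable {A : Finset ℕ} {S γ : ℕ → Finset ℕ} {D : ℕ}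

/-- Regret of the one-dimensional algorithm against a constant `U`, as long as the argument of the
logarithm is not close to `1`. -/
theorem scalePrediction_regret (h : IsDelayed A S γ D) (hD : 1 ≤ D) {ν B ε U G L : ℝ} (hν : 0 < ν)
    (hB : 0 < B + ε) (hG : 0 < G) (hBG : B + ε ≤ 7 * G) (hU : 0 ≤ U) (l : ℕ → ℝ)
    (hx : ∀ t ∈ A, |l t + ε| ≤ B + ε) {T : ℕ} (hT : ∀ t ∈ A, t < T)
    (hR : 1 ≤ ν⁻¹ * D * U * A.card * G) (hL : L = Real.log (1 + ν⁻¹ * D * U * A.card * G)) :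
    ∑ t ∈ A, (scalePrediction ν D B ε S γ l t - U) * (l t + ε) ≤
      ν + 800 * U * (√((1 + totalLag A γ (fun s => |l s + ε|) T) * L) + (B + ε) * D * L) := by
  have hsum := sum_scalePrediction_mul_le h hν.le hB l hx hT
  set a := ((B + ε) * 20 * (1 + 2 * (D : ℝ)))⁻¹ with ha
  have ha0 : 0 < a := by positivity
  set Z := ∫ η in (0 : ℝ)..a, Real.exp (-η ^ 2) with hZ
  have hZ0 : 0 < Z := integral_exp_neg_sq_pos ha0
  set Λ := totalLag A γ (fun s => |l s + ε|) T with hΛ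
  have habs : ∀ t ∈ A, 0 ≤ |l t + ε| := fun t _ => abs_nonneg _
  have hΛ0 : 0 ≤ Λ := h.totalLag_nonneg habs T
  set Y := -∑ t ∈ A, (l t + ε) with hYdef
  have hpot : ∀ η, potential A γ (fun s => l s + ε) η T * Real.exp (-η ^ 2) =
      Real.exp (η * Y - η ^ 2 * (1 + Λ)) := by
    intro η
    unfold potential
    rw [← Real.exp_add, past_eq_self hT, hYdef]
    congr 1
    ring
  simp only [hpot] at hsum
  have hsplit : ∑ t ∈ A, (scalePrediction ν D B ε S γ l t - U) * (l t + ε) =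
      ∑ t ∈ A, scalePrediction ν D B ε S γ l t * (l t + ε) + U * Y := by
    rw [hYdef, mul_neg, Finset.mul_sum, ← sub_eq_add_neg, ← Finset.sum_sub_distrib]
    exact Finset.sum_congr rfl fun t _ => by ring
  have hLpos : 0 ≤ L := by rw [hL]; exact Real.log_nonneg (by linarith)
  rw [hsplit]
  rcases le_or_gt Y (800 * (√((1 + Λ) * L) + (B + ε) * D * L)) with hY | hY
  · have e1 := mul_le_mul_of_nonneg_left hY hU
    have e2 : 0 ≤ (∫ η in (0 : ℝ)..a, Real.exp (η * Y - η ^ 2 * (1 + Λ))) / Z :=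
      div_nonneg (intervalIntegral.integral_nonneg ha0.le fun η _ => (Real.exp_pos _).le) hZ0.le
    have e3 := mul_nonneg hν.le e2
    linarith
  · have hΛn : Λ ≤ A.card * ((1 + 2 * D) * (B + ε) ^ 2) := by
      have e : Λ ≤ ∑ t ∈ past A T, (1 + 2 * D) * (B + ε) ^ 2 :=
        Finset.sum_le_sum fun t ht => h.lag_increment_le hB.le habs hx (mem_past.1 ht).1
      rwa [past_eq_self hT, Finset.sum_const, nsmul_eq_mul] at e
    have hYn : Y ≤ A.card * (B + ε) := by
      have e : Y ≤ ∑ t ∈ A, (B + ε) := by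
        rw [hYdef, ← Finset.sum_neg_distrib]
        exact Finset.sum_le_sum fun t ht => (neg_le_abs _).trans (hx t ht)
      rwa [Finset.sum_const, nsmul_eq_mul] at e
    have key := mul_le_integral_div hD (inv_nonneg.2 hν.le) hU hG hB hBG hR hL
      (by linarith : 1 ≤ 1 + Λ) (by linarith) hYn ha hZ0 (integral_exp_neg_sq_le ha0.le)
      (integral_exp_neg_sq_le_two ha0.le) hY
    have e1 := mul_le_mul_of_nonneg_left key hν.le
    rw [← mul_assoc, mul_inv_cancel₀ hν.ne', one_mul] at e1
    have e2 : 0 ≤ 800 * U * (√((1 + Λ) * L) + (B + ε) * D * L) := by positivity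
    linarith

end Tuning

/-! ### Regret of the combined algorithm -/

section Combined

variable {A : Finset ℕ} {S γ : ℕ → Finset ℕ} {D : ℕ} {d : ℕ}

/-- Effect of an error `δ` in the gradient norms on the lag. -/
theorem totalLag_le_add (h : IsDelayed A S γ D) (hD : 1 ≤ D) {a p : ℕ → ℝ} {δ G : ℝ}
    (hδ : 0 ≤ δ) (hδG : δ ≤ 6 * G) (ha : ∀ t ∈ A, 0 ≤ a t) (hp : ∀ t ∈ A, 0 ≤ p t)
    (hpG : ∀ t ∈ A, p t ≤ G) (hap : ∀ t ∈ A, a t ≤ p t + δ) {T : ℕ} (hT : ∀ t ∈ A, t < T) :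
    totalLag A γ a T ≤ totalLag A γ p T + 24 * A.card * δ * G * D := by
  have hG : 0 ≤ G := by linarith
  have hD' : (1 : ℝ) ≤ D := by exact_mod_cast hD
  have hterm : ∀ t ∈ A, a t ^ 2 + 2 * a t * ∑ i ∈ γ t, a i ≤
      (p t ^ 2 + 2 * p t * ∑ i ∈ γ t, p i) + 24 * δ * G * D := by
    intro t ht
    have h1 := ha t ht
    have h2 := hp t ht
    have h3 := hpG t ht
    have h4 := hap t ht
    have hc : ((γ t).card : ℝ) ≤ D := by exact_mod_cast h.card_missing_le ht
    have hs0 : 0 ≤ ∑ i ∈ γ t, a i := h.sum_missing_nonneg ha ht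
    have hs1 : ∑ i ∈ γ t, a i ≤ ∑ i ∈ γ t, p i + D * δ := by
      have e : ∑ i ∈ γ t, a i ≤ ∑ i ∈ γ t, (p i + δ) :=
        Finset.sum_le_sum fun i hi => hap i (h.mem_of_mem_missing ht hi)
      rw [Finset.sum_add_distrib, Finset.sum_const, nsmul_eq_mul] at e
      nlinarith
    have hs2 : ∑ i ∈ γ t, p i ≤ D * G := h.sum_missing_le hG hpG ht
    have e1 : a t ^ 2 ≤ (p t + δ) ^ 2 := pow_le_pow_left₀ h1 h4 2
    have e2 : a t * ∑ i ∈ γ t, a i ≤ (p t + δ) * (∑ i ∈ γ t, p i + D * δ) :=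
      mul_le_mul h4 hs1 hs0 (by linarith)
    have e3 : p t * δ ≤ G * δ := mul_le_mul_of_nonneg_right h3 hδ
    have e4 : δ * δ ≤ 6 * G * δ := mul_le_mul_of_nonneg_right hδG hδ
    have e5 : G * δ ≤ D * (G * δ) := le_mul_of_one_le_left (by positivity) hD'
    have e6 : D * (p t * δ) ≤ D * (G * δ) := by gcongr
    have e7 : D * (δ * δ) ≤ D * (6 * G * δ) := by gcongr
    have e8 : δ * ∑ i ∈ γ t, p i ≤ δ * (D * G) := by gcongr
    nlinarith
  unfold totalLag
  rw [past_eq_self hT]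
  refine (Finset.sum_le_sum hterm).trans (le_of_eq ?_)
  rw [Finset.sum_add_distrib, Finset.sum_const, nsmul_eq_mul]
  ring

theorem sqrt_mul_add_le {Λ n ε G D L : ℝ} (hΛ : 0 ≤ Λ) (hn : 0 ≤ n) (hε : 0 ≤ ε) (hG : 0 ≤ G)
    (hD : 0 ≤ D) (hL : 0 ≤ L) :
    √((1 + (Λ + 24 * n * (2 * ε) * G * D)) * L) ≤
      √((1 + Λ) * L) + 4 * (ε * n + G * D * L) := by
  have h1 : (1 + (Λ + 24 * n * (2 * ε) * G * D)) * L =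
      (1 + Λ) * L + 48 * ((ε * n) * (G * D * L)) := by ring
  have hx : 0 ≤ ε * n := by positivity
  have hy : 0 ≤ G * D * L := by positivity
  have h0 : 0 ≤ (1 + Λ) * L := by positivity
  rw [h1]
  refine Real.sqrt_le_iff.2 ⟨by positivity, ?_⟩
  have h2 := Real.sq_sqrt h0
  have h3 := Real.sqrt_nonneg ((1 + Λ) * L)
  have h4 : 0 ≤ √((1 + Λ) * L) * (ε * n + G * D * L) := by positivity
  nlinarith [sq_nonneg (ε * n - G * D * L), mul_nonneg hx hy]

/-- The initial regularization of the direction learner is absorbed by the bound, because the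
logarithmic factor `L` is at least `log 2 > 0.69`. -/
theorem sqrt_add_sq_le {W W' G D L : ℝ} (hW' : W' ≤ W) (hW : 0 ≤ W) (hG : 0 ≤ G) (hD : 1 ≤ D)
    (hL : 0.69 ≤ L) :
    √(W' + ((2 * D + 1) * (4 * G)) ^ 2) ≤ 2 * √((1 + W) * L) + 24 * (G * D * L) := by
  have hL0 : 0 < L := lt_of_lt_of_le (by norm_num) hL
  have hGD : 0 ≤ G * D := by positivity
  have h1 : (2 * D + 1) * (4 * G) ≤ 24 * (G * D * L) := by
    have h2 : G * D * 0.69 ≤ G * D * L := mul_le_mul_of_nonneg_left hL hGD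
    nlinarith
  have h2 : ((2 * D + 1) * (4 * G)) ^ 2 ≤ (24 * (G * D * L)) ^ 2 :=
    pow_le_pow_left₀ (by positivity) h1 2
  have h3 : √((1 + W) * L) ^ 2 = (1 + W) * L := Real.sq_sqrt (by positivity)
  have h4 : 0 ≤ √((1 + W) * L) * (G * D * L) := by positivity
  have h5 : W * 0.69 ≤ W * L := mul_le_mul_of_nonneg_left hL hW
  refine Real.sqrt_le_iff.2 ⟨by positivity, ?_⟩
  have h6 : (2 * √((1 + W) * L) + 24 * (G * D * L)) ^ 2 =
      4 * √((1 + W) * L) ^ 2 + 96 * (√((1 + W) * L) * (G * D * L)) + (24 * (G * D * L)) ^ 2 := by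
    ring
  rw [h6, h3]
  linarith

theorem sum_scalePrediction_mul_le_self (h : IsDelayed A S γ D) {ν B ε : ℝ} (hν : 0 ≤ ν)
    (hB : 0 < B + ε) (l : ℕ → ℝ) (hx : ∀ t ∈ A, |l t + ε| ≤ B + ε) {T : ℕ}
    (hT : ∀ t ∈ A, t < T) :
    ∑ t ∈ A, scalePrediction ν D B ε S γ l t * (l t + ε) ≤ ν := by
  refine (sum_scalePrediction_mul_le h hν hB l hx hT).trans (sub_le_self _ ?_)
  have ha : 0 ≤ ((B + ε) * 20 * (1 + 2 * (D : ℝ)))⁻¹ := by positivity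
  refine mul_nonneg hν (div_nonneg (intervalIntegral.integral_nonneg ha fun η _ => ?_)
    (intervalIntegral.integral_nonneg ha fun η _ => (Real.exp_pos _).le))
  exact mul_nonneg (Real.exp_pos _).le (Real.exp_pos _).le

/-- Regret of the combined algorithm with compressed gradients `ghat`. If the argument of the
logarithm is small, the comparator gains at most `ν` and the bound on the cumulative loss suffices.
Otherwise the regret splits into that of the scale `v t` against `‖u‖`, that of the direction `z t`
against `u / ‖u‖`, and the compression error. -/
theorem combinedPrediction_regret (h : IsDelayed A S γ D) (hD : 1 ≤ D) {ν G ε : ℝ} (hν : 0 < ν)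
    (hG : 0 < G) (hε : 0 ≤ ε) (hεG : ε ≤ 3 * G) (g ghat : ℕ → Vec d) (hg : ∀ t ∈ A, ‖g t‖ ≤ G)
    (hghat : ∀ t ∈ A, ‖ghat t - g t‖ ≤ ε) {T : ℕ} (hT : ∀ t ∈ A, t < T) (u : Vec d) {L : ℝ}
    (hL : L = Real.log (1 + ν⁻¹ * D * ‖u‖ * A.card * G)) :
    ∑ t ∈ A, inner ℝ (combinedPrediction ν D (4 * G) ε S γ ghat t - u) (g t) ≤
      2 * ν + 9000 * ‖u‖ * (√((1 + totalLag A γ (fun s => ‖g s‖) T) * L) + G * D * L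
        + ε * A.card) := by
  set z : ℕ → Vec d := adaDelayDist D (4 * G) S γ ghat with hz
  set l : ℕ → ℝ := fun s => inner ℝ (z s) (ghat s) with hl
  set v : ℕ → ℝ := fun t => scalePrediction ν D (4 * G) ε S γ l t with hv
  set n : ℝ := (A.card : ℝ) with hn
  have hn0 : 0 ≤ n := Nat.cast_nonneg _
  have hD' : (1 : ℝ) ≤ D := by exact_mod_cast hD
  have hcomb : ∀ t, combinedPrediction ν D (4 * G) ε S γ ghat t = v t • z t := fun _ => rfl
  have hB : 0 < 4 * G + ε := by positivity
  have hBG : 4 * G + ε ≤ 7 * G := by linarith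
  have hv0 : ∀ t, 0 ≤ v t := fun t => scalePrediction_nonneg hν.le D hB S γ l t
  have hz1 : ∀ t, ‖z t‖ ≤ 1 := fun t => norm_projUnitBall_le _
  have hghatε : ∀ t ∈ A, ‖ghat t‖ ≤ ‖g t‖ + ε := fun t ht => by
    have := norm_le_norm_add_norm_sub' (ghat t) (g t)
    linarith [hghat t ht]
  have hghat4 : ∀ t ∈ A, ‖ghat t‖ ≤ 4 * G := fun t ht => by
    linarith [hghatε t ht, hg t ht]
  have hlabs : ∀ t, |l t| ≤ ‖ghat t‖ := fun t =>
    (abs_real_inner_le_norm _ _).trans (mul_le_of_le_one_left (norm_nonneg _) (hz1 t))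
  have hxabs : ∀ t, |l t + ε| ≤ ‖ghat t‖ + ε := fun t => by
    have := abs_add_le (l t) ε
    rw [abs_of_nonneg hε] at this
    linarith [hlabs t]
  have hx : ∀ t ∈ A, |l t + ε| ≤ 4 * G + ε := fun t ht => by
    linarith [hxabs t, hghat4 t ht]
  have hloss : ∀ t ∈ A, v t * inner ℝ (z t) (g t) ≤ v t * (l t + ε) := by
    intro t ht
    refine mul_le_mul_of_nonneg_left ?_ (hv0 t)
    have e1 : inner ℝ (z t) (g t) = l t + inner ℝ (z t) (g t - ghat t) := by
      rw [inner_sub_right]; ring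
    have e2 : inner ℝ (z t) (g t - ghat t) ≤ ‖g t - ghat t‖ :=
      (real_inner_le_norm _ _).trans (mul_le_of_le_one_left (norm_nonneg _) (hz1 t))
    rw [norm_sub_rev] at e2
    linarith [hghat t ht]
  have hinner : ∀ t, inner ℝ (combinedPrediction ν D (4 * G) ε S γ ghat t - u) (g t) =
      v t * inner ℝ (z t) (g t) - inner ℝ u (g t) := by
    intro t
    rw [hcomb, inner_sub_left, inner_smul_left]
    simp
  have hR0 : 0 ≤ ν⁻¹ * D * ‖u‖ * n * G := by positivity
  have hL0 : 0 ≤ L := by rw [hL]; exact Real.log_nonneg (by linarith)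
  have hpnn : ∀ t ∈ A, 0 ≤ ‖g t‖ := fun t _ => norm_nonneg _
  set Λ := totalLag A γ (fun s => ‖g s‖) T with hΛ
  have hΛ0 : 0 ≤ Λ := h.totalLag_nonneg hpnn T
  have hQ0 := Real.sqrt_nonneg ((1 + Λ) * L)
  have hGDL : 0 ≤ G * D * L := by positivity
  have hεn : 0 ≤ ε * n := by positivity
  rcases le_total (ν⁻¹ * D * ‖u‖ * n * G) 1 with hR | hR
  · have e1 : ∑ t ∈ A, inner ℝ (combinedPrediction ν D (4 * G) ε S γ ghat t - u) (g t) ≤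
        ∑ t ∈ A, (v t * (l t + ε) + ‖u‖ * G) := by
      refine Finset.sum_le_sum fun t ht => ?_
      rw [hinner]
      have e2 : -(‖u‖ * ‖g t‖) ≤ inner ℝ u (g t) := neg_le_of_abs_le (abs_real_inner_le_norm _ _)
      have e3 : ‖u‖ * ‖g t‖ ≤ ‖u‖ * G := mul_le_mul_of_nonneg_left (hg t ht) (norm_nonneg _)
      linarith [hloss t ht]
    rw [Finset.sum_add_distrib, Finset.sum_const, nsmul_eq_mul] at e1
    have e2 : ∑ t ∈ A, v t * (l t + ε) ≤ ν := sum_scalePrediction_mul_le_self h hν.le hB l hx hT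
    have e3 : n * (‖u‖ * G) ≤ ν := by
      have f1 : ν * (ν⁻¹ * D * ‖u‖ * n * G) ≤ ν * 1 := mul_le_mul_of_nonneg_left hR hν.le
      have f2 : ν * (ν⁻¹ * D * ‖u‖ * n * G) = D * (n * (‖u‖ * G)) := by field_simp
      have f3 : n * (‖u‖ * G) ≤ D * (n * (‖u‖ * G)) := le_mul_of_one_le_left (by positivity) hD'
      linarith
    have e4 : 0 ≤ 9000 * ‖u‖ * (√((1 + Λ) * L) + G * D * L + ε * n) := by positivity
    linarith
  · have hu : 0 < ‖u‖ := by
      rcases (norm_nonneg u).eq_or_lt with h0 | h0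
      · rw [← h0] at hR
        simp at hR
        linarith
      · exact h0
    have hL2 : 0.69 < L := by
      rw [hL]
      refine lt_of_lt_of_le (lt_trans (by norm_num) Real.log_two_gt_d9)
        (Real.log_le_log two_pos (by linarith))
    obtain ⟨u', hu'1, huu'⟩ : ∃ u' : Vec d, ‖u'‖ ≤ 1 ∧ ∀ y, inner ℝ u y = ‖u‖ * inner ℝ u' y := by
      refine ⟨‖u‖⁻¹ • u, ?_, fun y => ?_⟩
      · rw [norm_smul, norm_inv, norm_norm, inv_mul_cancel₀ hu.ne']
      · rw [inner_smul_left, conj_trivial, ← mul_assoc, mul_inv_cancel₀ hu.ne', one_mul]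
    have hterm : ∀ t ∈ A, inner ℝ (combinedPrediction ν D (4 * G) ε S γ ghat t - u) (g t) ≤
        (v t - ‖u‖) * (l t + ε) + ‖u‖ * inner ℝ (z t - u') (ghat t) + 2 * ε * ‖u‖ := by
      intro t ht
      rw [hinner]
      have e1 : inner ℝ u (g t) = ‖u‖ * inner ℝ u' (ghat t) - inner ℝ u (ghat t - g t) := by
        rw [← huu', inner_sub_right]
        ring
      have e2 : inner ℝ u (ghat t - g t) ≤ ‖u‖ * ε :=
        (real_inner_le_norm _ _).trans (mul_le_mul_of_nonneg_left (hghat t ht) (norm_nonneg _))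
      have e3 : inner ℝ (z t - u') (ghat t) = l t - inner ℝ u' (ghat t) := inner_sub_left _ _ _
      rw [e1, e3]
      linarith [hloss t ht]
    have hsum := Finset.sum_le_sum hterm
    rw [Finset.sum_add_distrib, Finset.sum_add_distrib, ← Finset.mul_sum, Finset.sum_const,
      nsmul_eq_mul] at hsum
    have hscale := scalePrediction_regret h hD hν hB hG hBG hu.le l hx hT hR hL
    have hdir := adaDelayDist_regret h (by positivity : 0 < 4 * G) ghat hghat4 hT u' hu'1
    have hdir' := mul_le_mul_of_nonneg_left hdir hu.le
    have hlag1 : totalLag A γ (fun s => |l s + ε|) T ≤ Λ + 24 * n * (2 * ε) * G * D :=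
      totalLag_le_add h hD (by positivity) (by linarith) (fun t _ => abs_nonneg _) hpnn hg
        (fun t ht => by linarith [hxabs t, hghatε t ht]) hT
    have hlag2 : totalLag A γ (fun s => ‖ghat s‖) T ≤ Λ + 24 * n * (2 * ε) * G * D :=
      totalLag_le_add h hD (by positivity) (by linarith) (fun t _ => norm_nonneg _) hpnn hg
        (fun t ht => by linarith [hghatε t ht]) hT
    have hDnn : (0 : ℝ) ≤ D := by linarith
    have hW := sqrt_mul_add_le hΛ0 hn0 hε hG.le hDnn hL0
    set W := Λ + 24 * n * (2 * ε) * G * D with hWdef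
    have hW0 : 0 ≤ W := by positivity
    have hs1 : √((1 + totalLag A γ (fun s => |l s + ε|) T) * L) ≤ √((1 + W) * L) :=
      Real.sqrt_le_sqrt (mul_le_mul_of_nonneg_right (by linarith) hL0)
    have hs2 : √(totalLag A γ (fun s => ‖ghat s‖) T + ((2 * (D : ℝ) + 1) * (4 * G)) ^ 2) ≤
        2 * √((1 + W) * L) + 24 * (G * D * L) :=
      sqrt_add_sq_le hlag2 hW0 hG.le hD' hL2.le
    have hU1 := mul_le_mul_of_nonneg_left hs1 hu.le
    have hU2 := mul_le_mul_of_nonneg_left hs2 hu.le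
    have hU3 := mul_le_mul_of_nonneg_left hW hu.le
    have hU4 : ‖u‖ * ((4 * G + ε) * D * L) ≤ ‖u‖ * (7 * (G * D * L)) := by
      refine mul_le_mul_of_nonneg_left ?_ hu.le
      have : (4 * G + ε) * (D * L) ≤ 7 * G * (D * L) :=
        mul_le_mul_of_nonneg_right hBG (by positivity)
      linarith
    have p1 : 0 ≤ ‖u‖ * √((1 + Λ) * L) := by positivity
    have p2 : 0 ≤ ‖u‖ * (G * D * L) := by positivity
    have p3 : 0 ≤ ‖u‖ * (ε * n) := by positivity
    change _ ≤ (∑ t ∈ A, (v t - ‖u‖) * (l t + ε)) +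
      ‖u‖ * (∑ t ∈ A, inner ℝ (z t - u') (ghat t)) + n * (2 * ε * ‖u‖) at hsum
    change ∑ t ∈ A, (v t - ‖u‖) * (l t + ε) ≤ _ at hscale
    linarith

end Combined

/-! ### Regret over a partition -/

section Partition

variable {V : Type*} {𝒢 : SimpleGraph V} {d : ℕ} {Q : Finset 𝒢.Subgraph} {b : ℕ} {G : ℝ}

theorem mem_activeRounds {F : 𝒢.Subgraph} {I : ℕ → V} {T t : ℕ} :
    t ∈ activeRounds F I T ↔ t < T ∧ I t ∈ F.verts := by
  simp [activeRounds]

theorem past_activeRounds {F : 𝒢.Subgraph} {I : ℕ → V} {T t : ℕ} (ht : t < T) :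
    past (activeRounds F I T) t = (Finset.range t).filter fun s => I s ∈ F.verts := by
  ext s
  simp only [mem_past, mem_activeRounds, Finset.mem_filter, Finset.mem_range]
  constructor
  · rintro ⟨⟨_, h⟩, h'⟩
    exact ⟨h', h⟩
  · rintro ⟨h', h⟩
    exact ⟨⟨h'.trans ht, h⟩, h'⟩

/-- Rounding `b / D_Q` down to an integer costs at most a factor `2 ^ (1 / d) ≤ 2` in the
resolution. -/
theorem resolution_bitsPerGradient_le (Q : Finset 𝒢.Subgraph) {d : ℕ} (b : ℕ) {G : ℝ}
    (hd : 0 < d) (hG : 0 < G) :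
    resolution d (bitsPerGradient Q b) G ≤
      6 * ((2 : ℝ) ^ (-((b : ℝ) / ((d : ℝ) * (maxDelay Q : ℝ)))) * G) := by
  have hm : 0 < maxDelay Q := lt_of_lt_of_le one_pos (le_max_left _ _)
  have hm' : (0 : ℝ) < maxDelay Q := by exact_mod_cast hm
  have hd1 : (1 : ℝ) ≤ d := by exact_mod_cast hd
  have hfloor : (b : ℝ) / maxDelay Q ≤ bitsPerGradient Q b + 1 := by
    rw [div_le_iff₀ hm']
    have : b < maxDelay Q * (b / maxDelay Q + 1) := Nat.lt_mul_div_succ b hm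
    have h2 : (b : ℝ) < maxDelay Q * (((b / maxDelay Q : ℕ) : ℝ) + 1) := by exact_mod_cast this
    unfold bitsPerGradient
    linarith
  have hexp : -((bitsPerGradient Q b : ℝ) / d) ≤
      -((b : ℝ) / ((d : ℝ) * (maxDelay Q : ℝ))) + 1 := by
    have h1 : (b : ℝ) / ((d : ℝ) * (maxDelay Q : ℝ)) = (b : ℝ) / maxDelay Q / d := by
      rw [div_div, mul_comm]
    have h2 : (b : ℝ) / maxDelay Q / d ≤ ((bitsPerGradient Q b : ℝ) + 1) / d :=
      div_le_div_of_nonneg_right hfloor (by linarith)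
    have h3 : (1 : ℝ) / d ≤ 1 := (div_le_one (by linarith)).2 hd1
    rw [add_div] at h2
    rw [h1]
    linarith
  have hpow : (2 : ℝ) ^ (-((bitsPerGradient Q b : ℝ) / d)) ≤
      (2 : ℝ) ^ (-((b : ℝ) / ((d : ℝ) * (maxDelay Q : ℝ)))) * 2 := by
    refine (Real.rpow_le_rpow_of_exponent_le one_le_two hexp).trans (le_of_eq ?_)
    rw [Real.rpow_add two_pos, Real.rpow_one]
  unfold resolution
  nlinarith

theorem sum_activeRounds_eq_of_isQPartition {I : ℕ → V} {T : ℕ} {P : Finset 𝒢.Subgraph}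
    (hP : IsQPartition Q I T P) (c : ℕ → ℝ) :
    ∑ F ∈ P, ∑ t ∈ activeRounds F I T, c t = ∑ t ∈ Finset.range T, c t := by
  simp only [activeRounds, Finset.sum_filter]
  rw [Finset.sum_comm]
  refine Finset.sum_congr rfl fun t ht => ?_
  obtain ⟨F, hF, hIF⟩ := hP.covers t (Finset.mem_range.1 ht)
  rw [Finset.sum_eq_single F, if_pos hIF]
  · intro F' hF' hne
    refine if_neg fun hIF' => ?_
    exact Set.disjoint_left.1 (hP.disjoint F' hF' F hF hne) hIF' hIF
  · exact fun hF' => absurd hF hF'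

variable [Fintype V]

theorem isDelayed_subgraph {F : 𝒢.Subgraph} (hF : F.Connected) {Dmax : ℕ} (hD : delay F ≤ Dmax)
    (I : ℕ → V) (T : ℕ) :
    IsDelayed (activeRounds F I T) (available F Dmax I) (missing F Dmax I) (delay F) where
  available_subset t ht := by
    rw [past_activeRounds (mem_activeRounds.1 ht).1]
    exact available_subset F Dmax I t
  missing_eq t ht := by
    rw [past_activeRounds (mem_activeRounds.1 ht).1]
    rfl
  lt_add t ht i hi := lt_add_delay_of_mem_missing hF hD (mem_activeRounds.1 ht).2 hi

theorem lag_eq_totalLag (F : 𝒢.Subgraph) (Dmax : ℕ) (I : ℕ → V) (T : ℕ) (g : ℕ → Vec d) :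
    lag F Dmax I T g =
      totalLag (activeRounds F I T) (missing F Dmax I) (fun s => ‖g s‖) T := by
  unfold totalLag
  rw [past_eq_self fun t ht => (mem_activeRounds.1 ht).1]
  rfl

theorem subgraphIterate_regret {F : 𝒢.Subgraph} (hFQ : F ∈ Q) (hF : F.Connected) (hd : 0 < d)
    (hG : 0 < G) (I : ℕ → V) (T : ℕ) (g ghat : ℕ → Vec d) (hg : ∀ t < T, ‖g t‖ ≤ G)
    (hghat : ∀ t < T, ‖ghat t - g t‖ ≤ resolution d (bitsPerGradient Q b) G) (u : Vec d) :
    ∑ t ∈ activeRounds F I T, inner ℝ (subgraphIterate Q b G I ghat F t - u) (g t) ≤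
      2 * (1 / (Q.card : ℝ)) + 54000 * (‖u‖ *
        (√((1 + lag F (maxDelay Q) I T g) * logFactor Q F I T G u)
          + G * (delay F : ℝ) * logFactor Q F I T G u
          + (2 : ℝ) ^ (-((b : ℝ) / ((d : ℝ) * (maxDelay Q : ℝ))))
              * ((activeRounds F I T).card : ℝ) * G)) := by
  have hlt : ∀ t ∈ activeRounds F I T, t < T := fun t ht => (mem_activeRounds.1 ht).1
  have hdel : IsDelayed (activeRounds F I T) (available F (maxDelay Q) I)
    (missing F (maxDelay Q) I) (delay F) := isDelayed_subgraph hF (delay_le_maxDelay hFQ) I T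
  have hQ : (0 : ℝ) < Q.card := by exact_mod_cast Finset.card_pos.2 ⟨F, hFQ⟩
  have hlog : logFactor Q F I T G u = Real.log (1 + (1 / (Q.card : ℝ))⁻¹ * (delay F : ℝ) * ‖u‖ *
      ((activeRounds F I T).card : ℝ) * G) := by
    rw [one_div, inv_inv]; rfl
  have hreg := combinedPrediction_regret hdel (le_max_left _ _) (one_div_pos.2 hQ) hG
    (resolution_pos hG).le (resolution_le hG) g ghat (fun t ht => hg t (hlt t ht))
    (fun t ht => hghat t (hlt t ht)) hlt u hlog
  refine hreg.trans ?_
  rw [← lag_eq_totalLag]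
  have hL0 : 0 ≤ logFactor Q F I T G u := by
    unfold logFactor
    exact Real.log_nonneg (le_add_of_nonneg_right (by positivity))
  set L := logFactor Q F I T G u
  set n : ℝ := ((activeRounds F I T).card : ℝ)
  set r : ℝ := (2 : ℝ) ^ (-((b : ℝ) / ((d : ℝ) * (maxDelay Q : ℝ))))
  have hres : resolution d (bitsPerGradient Q b) G ≤ 6 * (r * G) :=
    resolution_bitsPerGradient_le Q b hd hG
  have e1 : ‖u‖ * (resolution d (bitsPerGradient Q b) G * n) ≤ ‖u‖ * (6 * (r * G) * n) := by
    gcongr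
  have e2 : 0 ≤ ‖u‖ * √((1 + lag F (maxDelay Q) I T g) * L) := by positivity
  have e3 : 0 ≤ ‖u‖ * (G * (delay F : ℝ) * L) := by positivity
  linarith

theorem sum_inner_prediction_eq (enc : Vec d → (Fin (bitsPerGradient Q b) → Bool))
    (dec : (Fin (bitsPerGradient Q b) → Bool) → Vec d) (I : ℕ → V) (g : ℕ → Vec d) (T : ℕ) :
    ∑ t ∈ Finset.range T, inner ℝ (prediction Q b G enc dec I g t) (g t) =
      ∑ F ∈ Q, ∑ t ∈ activeRounds F I T,
        inner ℝ (subgraphIterate Q b G I (fun s => dec (enc (g s))) F t) (g t) := by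
  simp only [activeRounds, prediction, sum_inner, Finset.sum_filter]
  rw [Finset.sum_comm]
  refine Finset.sum_congr rfl fun F _ => Finset.sum_congr rfl fun t _ => ?_
  split_ifs <;> simp

/-- The joint regret over a partition is at most the sum over all `F ∈ Q` of the linearized regret
of the copy on `F`, with comparator `u F` for members of the partition and `0` for the others. -/
theorem sum_regret_le {enc : Vec d → (Fin (bitsPerGradient Q b) → Bool)}
    {dec : (Fin (bitsPerGradient Q b) → Bool) → Vec d} {T : ℕ} {I : ℕ → V}
    {loss : ℕ → Vec d → ℝ} {g : ℕ → Vec d}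
    (hsub : ∀ t < T, IsSubgradientAt (loss t) (g t) (prediction Q b G enc dec I g t))
    {P : Finset 𝒢.Subgraph} (hP : IsQPartition Q I T P) (u : 𝒢.Subgraph → Vec d) :
    ∑ F ∈ P, regret F I T loss (prediction Q b G enc dec I g) (u F) ≤
      ∑ F ∈ Q, ∑ t ∈ activeRounds F I T,
        inner ℝ (subgraphIterate Q b G I (fun s => dec (enc (g s))) F t
          - if F ∈ P then u F else 0) (g t) := by
  have h1 : ∑ F ∈ P, regret F I T loss (prediction Q b G enc dec I g) (u F) ≤
      ∑ F ∈ P, ∑ t ∈ activeRounds F I T,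
        (inner ℝ (prediction Q b G enc dec I g t) (g t) - inner ℝ (u F) (g t)) := by
    refine Finset.sum_le_sum fun F _ => Finset.sum_le_sum fun t ht => ?_
    have := hsub t (mem_activeRounds.1 ht).1 (u F)
    rw [real_inner_comm, inner_sub_left] at this
    linarith
  refine h1.trans (le_of_eq ?_)
  simp only [Finset.sum_sub_distrib, inner_sub_left]
  rw [sum_activeRounds_eq_of_isQPartition hP, sum_inner_prediction_eq]
  congr 1
  rw [← Finset.sum_subset hP.subset (f := fun F => ∑ t ∈ activeRounds F I T,
    inner ℝ (if F ∈ P then u F else 0) (g t))]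
  · exact Finset.sum_congr rfl fun F hF => by simp [hF]
  · intro F _ hF
    simp [hF]

end Partition

end DOCO

theorem mainTheorem1 :
    ∃ C : ℝ, 0 < C ∧
      ∀ (V : Type*) [Fintype V] (𝒢 : SimpleGraph V) (Q : Finset 𝒢.Subgraph)
        (_ : ∀ F ∈ Q, F.Connected) (d b : ℕ) (G : ℝ) (_ : 0 < d) (_ : 0 < G),
        -- an encoding with the required number of bits and resolution exists
        (∃ (enc : DOCO.Vec d → (Fin (DOCO.bitsPerGradient Q b) → Bool))
            (dec : (Fin (DOCO.bitsPerGradient Q b) → Bool) → DOCO.Vec d),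
            DOCO.IsCoverEncoding (DOCO.bitsPerGradient Q b) G enc dec) ∧
        -- no node ever sends more than `b` bits in a round
        (∀ (I : ℕ → V) (t : ℕ) (n : V) (s : Finset ℕ),
            (∀ i ∈ s, ∃ F ∈ Q, i ∈ DOCO.message F (DOCO.maxDelay Q) I t n) →
            s.card * DOCO.bitsPerGradient Q b ≤ b) ∧
        -- the regret bound
        ∀ (enc : DOCO.Vec d → (Fin (DOCO.bitsPerGradient Q b) → Bool))
          (dec : (Fin (DOCO.bitsPerGradient Q b) → Bool) → DOCO.Vec d),
          DOCO.IsCoverEncoding (DOCO.bitsPerGradient Q b) G enc dec →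
          ∀ (T : ℕ) (I : ℕ → V) (loss : ℕ → DOCO.Vec d → ℝ) (g : ℕ → DOCO.Vec d),
            (∀ t < T, ConvexOn ℝ Set.univ (loss t)) →
            (∀ t < T, ‖g t‖ ≤ G) →
            (∀ t < T,
              DOCO.IsSubgradientAt (loss t) (g t) (DOCO.prediction Q b G enc dec I g t)) →
            ∀ (P : Finset 𝒢.Subgraph), DOCO.IsQPartition Q I T P →
            ∀ u : 𝒢.Subgraph → DOCO.Vec d,
              ∑ F ∈ P, DOCO.regret F I T loss (DOCO.prediction Q b G enc dec I g) (u F) ≤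
                C * (1 + ∑ F ∈ P, ‖u F‖ *
                  (√((1 + DOCO.lag F (DOCO.maxDelay Q) I T g) * DOCO.logFactor Q F I T G (u F))
                    + G * (DOCO.delay F : ℝ) * DOCO.logFactor Q F I T G (u F)
                    + (2 : ℝ) ^ (-((b : ℝ) / ((d : ℝ) * (DOCO.maxDelay Q : ℝ))))
                        * ((DOCO.activeRounds F I T).card : ℝ) * G)) := by
  classical
  refine ⟨54000, by norm_num, ?_⟩
  intro V _ 𝒢 Q hQ d b G hd hG
  refine ⟨DOCO.exists_isCoverEncoding hd hG, DOCO.card_mul_bitsPerGradient_le Q b, ?_⟩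
  intro enc dec henc T I loss g _ hg hsub P hP u
  refine (DOCO.sum_regret_le hsub hP u).trans ?_
  refine (Finset.sum_le_sum fun F hF => DOCO.subgraphIterate_regret hF (hQ F hF) hd hG I T g
    (fun s => dec (enc (g s))) hg (fun t ht => henc (g t) (hg t ht)) _).trans ?_
  rw [Finset.sum_add_distrib, Finset.sum_const, nsmul_eq_mul, ← Finset.mul_sum, mul_add, mul_one]
  have hcard : (Q.card : ℝ) * (2 * (1 / (Q.card : ℝ))) ≤ 54000 := by
    rcases eq_or_ne (Q.card : ℝ) 0 with h | h
    · rw [h]; norm_num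
    · field_simp
      norm_num
  refine add_le_add hcard (mul_le_mul_of_nonneg_left (le_of_eq ?_) (by norm_num))
  rw [← Finset.sum_subset hP.subset]
  · exact Finset.sum_congr rfl fun F hF => by simp only [if_pos hF]
  · intro F _ hF
    rw [if_neg hF, norm_zero, zero_mul]
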